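/- Let $q\ge 2$ be an integer and $\Sigma_q=\{0,1,\dots,q-1\}$. For $x\in\Sigma_q^n$ let $\mathcal B^{\rm S}_q(x)$ be the set of words obtained from $x$ by at most one substitution, $\mathcal B^{\rm I}_q(x)\subseteq\Sigma_q^{n+1}$ the set of words obtained from $x$ by exactly one insertion, and $\mathcal B^{\rm SI}_q(x)=\mathcal B^{\rm S}_q(x)\cup\mathcal B^{\rm I}_q(x)$. For a code $\mathcal C\subseteq\Sigma_q^n$ let $$\nu(\mathcal C;\mathcal B^{\rm SI}_q)=\max\{|\mathcal B^{\rm SI}_q(x)\cap\mathcal B^{\rm SI}_q(y)| : x,y\in\mathcal C,\ x\neq y\}$$ (with the maximum read as $0$ when $|\mathcal C|\le 1$), and for $N\ge 1$ let $$\rho(n,N;\mathcal B^{\rm SI}_q)=\min\{\,n-\log_q|\mathcal C| : \varnothing\neq\mathcal C\subseteq\Sigma_q^n,\ \nu(\mathcal C;\mathcal B^{\rm SI}_q)<N\,\}.$$ Then, with $q$ and $N$ fixed, asymptotic notation referring to $n\to\infty$, and exact (in)equalities holding for every $n\ge 1$: 1. If $N\in\{1,2\}$ and $q=2$, then $|\rho(n,N;\mathcal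 B^{\rm SI}_2)-\log_2 n|=O(1)$. 2. If $N\in\{1,2\}$ and $q\ge 3$, then $|\rho(n,N;\mathcal B^{\rm SI}_q)-\log_q n|=O(\log_q\log_q n)$. 3. If $N=3$, then $|\rho(n,3;\mathcal B^{\rm SI}_q)-\log_q\log_q n|=O(1)$. 4. If $N=4$, then $\rho(n,4;\mathcal B^{\rm SI}_q)=2-\epsilon(n)$ where $\epsilon(n)\ge 0$; moreover, if $q=2$ there is a real function $\delta(n)\to 0$ (of unrestricted sign) with $\epsilon(n)\le\log_2(4/3)-\delta(n)$, and if $q\ge 3$ then $\epsilon(n)\le 1$. 5. If $5\le N\le q+2$, then $\rho(n,N;\mathcal B^{\rm SI}_q)=1$. 6. If $N\ge q+3$, then $\rho(n,N;\mathcal B^{\rm SI}_q)=0$. -/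

import Mathlib

open scoped Asymptotics

namespace Reconstruction

/-- Words of length `n` over the alphabet `{0, 1, …, q - 1}`. -/
abbrev Word (q n : ℕ) : Type := Fin n → Fin q

/-- The single-substitution ball: all words obtained by at most one substitution.
Noisy reads may have different lengths, so they are recorded as lists. -/
def subBall {q n : ℕ} (x : Word q n) : Finset (List (Fin q)) :=
  (Finset.univ.filter fun y : Word q n => hammingDist x y ≤ 1).image List.ofFn

/-- The single-insertion ball: all words of length `n + 1` obtained by inserting exactly one symbol
`p.2`, at position `p.1`. -/
def insBall {q n : ℕ} (x : Word q n) : Finset (List (Fin q)) :=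
  Finset.univ.image fun p : Fin (n + 1) × Fin q =>
    List.ofFn (Fin.insertNth (α := fun _ => Fin q) p.1 p.2 x)

/-- The single-substitution/insertion ball. -/
def siBall {q n : ℕ} (x : Word q n) : Finset (List (Fin q)) :=
  subBall x ∪ insBall x

/-- The read coverage `ν(C; B)`: the maximum of `|B x ∩ B y|` over pairs of distinct codewords
(and `0` if there are no such pairs). -/
def readCoverage {X Y : Type*} [DecidableEq X] [DecidableEq Y]
    (B : X → Finset Y) (C : Finset X) : ℕ :=
  C.offDiag.sup fun p => (B p.1 ∩ B p.2).card

/-- `C` is an `(n, N; B)`-reconstruction code. -/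
def IsReconstructionCode {q n : ℕ} {Y : Type*} [DecidableEq Y]
    (B : Word q n → Finset Y) (N : ℕ) (C : Finset (Word q n)) : Prop :=
  readCoverage B C < N

/-- The redundancies `n - log_q |C|` of the (nonempty) `(n, N; B)`-reconstruction codes `C`. -/
def redundancies {q n : ℕ} {Y : Type*} [DecidableEq Y]
    (B : Word q n → Finset Y) (N : ℕ) : Set ℝ :=
  {r | ∃ C : Finset (Word q n), C.Nonempty ∧ IsReconstructionCode B N C ∧
    r = (n : ℝ) - Real.logb q C.card}

/-- The optimal redundancy `ρ(n, N; B)`. -/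
noncomputable def optRedundancy {q n : ℕ} {Y : Type*} [DecidableEq Y]
    (B : Word q n → Finset Y) (N : ℕ) : ℝ :=
  sInf (redundancies B N)

/-- The infimum defining `ρ(n, N; B)` is a minimum. -/
theorem optRedundancy_isLeast {q n : ℕ} {Y : Type*} [DecidableEq Y]
    (B : Word q n → Finset Y) {N : ℕ} (hq : 0 < q) (hN : 0 < N) :
    IsLeast (redundancies B N) (optRedundancy B N) := by
  have hfin : (redundancies B N).Finite := by
    refine (Set.finite_range
      fun C : Finset (Word q n) => (n : ℝ) - Real.logb q C.card).subset ?_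
    rintro r ⟨C, -, -, rfl⟩
    exact ⟨C, rfl⟩
  have hne : (redundancies B N).Nonempty := by
    refine ⟨_, {fun _ => ⟨0, hq⟩}, Finset.singleton_nonempty _, ?_, rfl⟩
    simpa [IsReconstructionCode, readCoverage] using hN
  exact ⟨hne.csInf_mem hfin, fun r hr => csInf_le hfin.bddBelow hr⟩

/-- `ρ(n, N; B)` for the single-substitution/insertion ball over the `q`-ary alphabet. -/
noncomputable def rhoSI (q n N : ℕ) : ℝ :=
  optRedundancy (siBall : Word q n → Finset (List (Fin q))) N

end Reconstruction

namespace Reconstruction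

variable {q n : ℕ}

/-! Let `s` and `t` count the common substitution and insertion outputs of two distinct words. Their
lengths differ, so the balls meet in exactly `s + t` words. Always `t ≤ 2`, since a common
supersequence is determined by which word has the earlier deletion. Moreover `s ≤ q` at Hamming
distance one, `s ≤ 2` at distance two, and `s = 0` beyond. So `N ≥ q + 3` imposes nothing, and for
`5 ≤ N ≤ q + 2` exactly distance one must be avoided, which one parity check does.

For smaller `N` the question is which pairs at distance two also share insertions. If `t = 2`, they
differ by an adjacent transposition (`DelPair.adjacent`), and a second check, on the even positions,
settles `N = 4`. If `t ≥ 1`, one word is constant from the first differing position to just before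
the second (`DelPair.run_left`). For `N = 3` it thus suffices to take words with logarithmic runs
and a first moment modulo `O(log n)`. For `N ≤ 2` a Varshamov–Tenengolts moment modulo `O(n)` forces
`s = t = 0` over two letters. Over more letters, the letter `c` gets weight `G ^ c` with `G` of
order `log n`, and the words are those with the largest letter in every logarithmic window; then the
moment difference cannot cancel.

Lower bounds: `s > 0` implies `s ≥ 2`, so for `N ≤ 2` the substitution balls are disjoint and sphere
packing applies. For `N = 3`, and for `N = 4` over two letters, take a set `D` of words of equal
length any two of which, in the same context, give `N` common outputs; codes then have density about
`1 / |D|` at most (`card_mul_le_of_clique`). -/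

/-! ### Splitting the balls by length -/

/-- The single-substitution ball as a set of words. -/
def subWords (x : Word q n) : Finset (Word q n) :=
  Finset.univ.filter fun y => hammingDist x y ≤ 1

/-- The single-insertion ball as a set of words. -/
def insWords (x : Word q n) : Finset (Word q (n + 1)) :=
  Finset.univ.image fun p : Fin (n + 1) × Fin q =>
    Fin.insertNth (α := fun _ => Fin q) p.1 p.2 x

theorem mem_subWords {x y : Word q n} : y ∈ subWords x ↔ hammingDist x y ≤ 1 := by
  simp [subWords]

theorem mem_insWords {x : Word q n} {z : Word q (n + 1)} :
    z ∈ insWords x ↔ ∃ p : Fin (n + 1), ∀ k, x k = z (p.succAbove k) := by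
  simp only [insWords, Finset.mem_image, Finset.mem_univ, true_and, Prod.exists]
  constructor
  · rintro ⟨p, a, rfl⟩
    exact ⟨p, fun k => by simp⟩
  · rintro ⟨p, h⟩
    refine ⟨p, z p, ?_⟩
    have : x = Fin.removeNth p z := funext h
    rw [this, Fin.insertNth_self_removeNth]

theorem insBall_eq_image (x : Word q n) : insBall x = (insWords x).image List.ofFn := by
  rw [insBall, insWords, Finset.image_image]
  rfl

theorem card_siBall_inter (x y : Word q n) :
    (siBall x ∩ siBall y).card =
      (subWords x ∩ subWords y).card + (insWords x ∩ insWords y).card := by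
  have hS : ∀ x : Word q n, subBall x = (subWords x).image List.ofFn := fun _ => rfl
  have hdis : ∀ (A : Finset (Word q n)) (B : Finset (Word q (n + 1))),
      Disjoint (A.image List.ofFn) (B.image List.ofFn) := by
    intro A B
    rw [Finset.disjoint_left]
    intro l h1 h2
    obtain ⟨a, -, rfl⟩ := Finset.mem_image.1 h1
    obtain ⟨b, -, hb⟩ := Finset.mem_image.1 h2
    have := congrArg List.length hb
    simp at this
  have key : siBall x ∩ siBall y =
      (subWords x ∩ subWords y).image List.ofFn ∪ (insWords x ∩ insWords y).image List.ofFn := by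
    rw [Finset.image_inter _ _ List.ofFn_injective, Finset.image_inter _ _ List.ofFn_injective,
      siBall, siBall, hS, hS, insBall_eq_image, insBall_eq_image, Finset.union_inter_distrib_right,
      Finset.inter_union_distrib_left, Finset.inter_union_distrib_left,
      Finset.disjoint_iff_inter_eq_empty.1 (hdis _ _),
      Finset.disjoint_iff_inter_eq_empty.1 (hdis _ _).symm]
    simp
  rw [key, Finset.card_union_of_disjoint (hdis _ _),
    Finset.card_image_of_injective _ List.ofFn_injective,
    Finset.card_image_of_injective _ List.ofFn_injective]

theorem append_cons_mem_insBall {x : Word q n} {u v : List (Fin q)} {a : Fin q}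
    (hx : List.ofFn x = u ++ v) : u ++ a :: v ∈ insBall x := by
  have hlen : n = u.length + v.length := by
    simpa using congrArg List.length hx
  rw [insBall_eq_image, Finset.mem_image]
  refine ⟨fun k => (u ++ a :: v)[k.1]'(by simp; omega), ?_, ?_⟩
  · rw [mem_insWords]
    refine ⟨⟨u.length, by omega⟩, fun k => ?_⟩
    have h1 : x k = (u ++ v)[k.1]'(by simp; omega) := by
      simp [← hx]
    rw [h1]
    rcases lt_or_ge k.1 u.length with h | h
    · rw [Fin.succAbove_of_castSucc_lt _ _ (by simpa [Fin.lt_def] using h)]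
      simp [h]
    · rw [Fin.succAbove_of_le_castSucc _ _ (by simpa [Fin.le_def] using h)]
      have h2 : ¬ (k.1 + 1 < u.length) := by omega
      have h3 : k.1 + 1 - u.length = (k.1 - u.length) + 1 := by omega
      simp [List.getElem_append, h3, h2, not_lt.2 h]
  · apply List.ext_getElem
    · simp; omega
    · intro i h1 h2
      rw [List.getElem_ofFn]

theorem append_cons_mem_subBall {x : Word q n} {u v : List (Fin q)} {a : Fin q} (b : Fin q)
    (hx : List.ofFn x = u ++ a :: v) : u ++ b :: v ∈ subBall x := by
  have hlen : n = u.length + (v.length + 1) := by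
    simpa using congrArg List.length hx
  have hx' : ∀ k : Fin n, x k = (u ++ a :: v)[k.1]'(by simp; omega) := by
    intro k; simp [← hx]
  rw [subBall, Finset.mem_image]
  refine ⟨fun k => (u ++ b :: v)[k.1]'(by simp; omega), ?_, ?_⟩
  · rw [Finset.mem_filter]
    refine ⟨Finset.mem_univ _, ?_⟩
    rw [hammingDist, Finset.card_le_one]
    have : ∀ k : Fin n, x k ≠ (u ++ b :: v)[k.1]'(by simp; omega) → k.1 = u.length := by
      intro k hk
      by_contra hne
      apply hk
      rw [hx']
      rcases lt_or_gt_of_ne hne with h | h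
      · simp [h]
      · obtain ⟨t, ht⟩ : ∃ t, k.1 - u.length = t + 1 := ⟨k.1 - u.length - 1, by omega⟩
        simp [List.getElem_append, ht, not_lt.2 h.le]
    intro i hi j hj
    simp only [Finset.mem_filter, Finset.mem_univ, true_and] at hi hj
    exact Fin.ext ((this i hi).trans (this j hj).symm)
  · apply List.ext_getElem
    · simp; omega
    · intro i h1 h2
      rw [List.getElem_ofFn]

theorem mem_siBall_of_insert {x : Word q n} {u v : List (Fin q)} {a : Fin q}
    (hx : List.ofFn x = u ++ v) : u ++ a :: v ∈ siBall x :=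
  Finset.mem_union_right _ (append_cons_mem_insBall hx)

theorem mem_siBall_of_subst {x : Word q n} {u v : List (Fin q)} {a : Fin q} (b : Fin q)
    (hx : List.ofFn x = u ++ a :: v) : u ++ b :: v ∈ siBall x :=
  Finset.mem_union_left _ (append_cons_mem_subBall b hx)

/-! ### Local changes that force common outputs -/

/-- Two words at Hamming distance one share at least `q + 2` outputs. -/
theorem card_siBall_inter_of_subst {x y : Word q n} {u v : List (Fin q)} {a b : Fin q}
    (hab : a ≠ b) (hx : List.ofFn x = u ++ a :: v) (hy : List.ofFn y = u ++ b :: v) :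
    q + 2 ≤ (siBall x ∩ siBall y).card := by
  have hsub : (Finset.univ.image fun c : Fin q => u ++ c :: v) ∪
      {u ++ a :: b :: v, u ++ b :: a :: v} ⊆ siBall x ∩ siBall y := by
    intro l hl
    rw [Finset.mem_union, Finset.mem_image, Finset.mem_insert, Finset.mem_singleton] at hl
    rw [Finset.mem_inter]
    rcases hl with ⟨c, -, rfl⟩ | rfl | rfl
    · exact ⟨mem_siBall_of_subst c hx, mem_siBall_of_subst c hy⟩
    · refine ⟨?_, mem_siBall_of_insert hy⟩
      have := mem_siBall_of_insert (x := x) (u := u ++ [a]) (v := v) (a := b) (by simpa using hx)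
      simpa using this
    · refine ⟨mem_siBall_of_insert hx, ?_⟩
      have := mem_siBall_of_insert (x := y) (u := u ++ [b]) (v := v) (a := a) (by simpa using hy)
      simpa using this
  refine le_trans (le_of_eq ?_) (Finset.card_le_card hsub)
  rw [Finset.card_union_of_disjoint, Finset.card_image_of_injective, Finset.card_pair,
    Finset.card_univ, Fintype.card_fin]
  · intro h
    simp at h
    exact hab h.1
  · intro c d h
    simpa using h
  · rw [Finset.disjoint_left]
    intro l h1 h2
    obtain ⟨c, -, rfl⟩ := Finset.mem_image.1 h1
    rw [Finset.mem_insert, Finset.mem_singleton] at h2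
    rcases h2 with h2 | h2 <;> simpa using congrArg List.length h2

/-- Two words that differ in an adjacent transposition share at least four outputs. -/
theorem card_siBall_inter_of_swap {x y : Word q n} {u v : List (Fin q)} {a b : Fin q}
    (hab : a ≠ b) (hx : List.ofFn x = u ++ a :: b :: v) (hy : List.ofFn y = u ++ b :: a :: v) :
    4 ≤ (siBall x ∩ siBall y).card := by
  have hsub : ({u ++ a :: a :: v, u ++ b :: b :: v, u ++ a :: b :: a :: v, u ++ b :: a :: b :: v} :
      Finset (List (Fin q))) ⊆ siBall x ∩ siBall y := by
    intro l hl
    simp only [Finset.mem_insert, Finset.mem_singleton] at hl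
    rw [Finset.mem_inter]
    rcases hl with rfl | rfl | rfl | rfl
    · refine ⟨?_, mem_siBall_of_subst a hy⟩
      simpa using mem_siBall_of_subst (x := x) (u := u ++ [a]) (v := v) (a := b) a (by simpa using hx)
    · refine ⟨mem_siBall_of_subst b hx, ?_⟩
      simpa using mem_siBall_of_subst (x := y) (u := u ++ [b]) (v := v) (a := a) b (by simpa using hy)
    · refine ⟨?_, mem_siBall_of_insert hy⟩
      simpa using mem_siBall_of_insert (x := x) (u := u ++ [a, b]) (v := v) (a := a)
        (by simpa using hx)
    · refine ⟨mem_siBall_of_insert hx, ?_⟩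
      simpa using mem_siBall_of_insert (x := y) (u := u ++ [b, a]) (v := v) (a := b)
        (by simpa using hy)
  refine le_trans (le_of_eq ?_) (Finset.card_le_card hsub)
  have hne : ∀ {l l' : List (Fin q)}, l.length ≠ l'.length → l ≠ l' :=
    fun h h' => h (congrArg _ h')
  rw [Finset.card_insert_of_notMem, Finset.card_insert_of_notMem, Finset.card_pair]
  · simp [hab]
  · simp only [Finset.mem_insert, Finset.mem_singleton, not_or]
    exact ⟨hne (by simp), hne (by simp)⟩
  · simp only [Finset.mem_insert, Finset.mem_singleton, not_or]
    exact ⟨by simp [hab], hne (by simp), hne (by simp)⟩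

/-- Moving a letter across a run gives two words that share at least three outputs. -/
theorem card_siBall_inter_of_move {x y : Word q n} {u v : List (Fin q)} {a b : Fin q} {t : ℕ}
    (hab : a ≠ b) (hx : List.ofFn x = u ++ b :: (List.replicate t a ++ a :: v))
    (hy : List.ofFn y = u ++ a :: (List.replicate t a ++ b :: v)) :
    3 ≤ (siBall x ∩ siBall y).card := by
  have hsub : ({u ++ b :: (List.replicate t a ++ b :: v), u ++ a :: (List.replicate t a ++ a :: v),
      u ++ b :: a :: (List.replicate t a ++ b :: v)} :
      Finset (List (Fin q))) ⊆ siBall x ∩ siBall y := by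
    intro l hl
    simp only [Finset.mem_insert, Finset.mem_singleton] at hl
    rw [Finset.mem_inter]
    rcases hl with rfl | rfl | rfl
    · refine ⟨?_, mem_siBall_of_subst b hy⟩
      simpa using mem_siBall_of_subst (x := x) (u := u ++ b :: List.replicate t a) (v := v) (a := a)
        b (by simpa using hx)
    · refine ⟨mem_siBall_of_subst a hx, ?_⟩
      simpa using mem_siBall_of_subst (x := y) (u := u ++ a :: List.replicate t a) (v := v) (a := b)
        a (by simpa using hy)
    · refine ⟨?_, mem_siBall_of_insert hy⟩
      have h1 : List.replicate t a ++ a :: v = a :: (List.replicate t a ++ v) := by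
        rw [← List.singleton_append, ← List.append_assoc, ← List.replicate_succ',
          List.replicate_succ, List.cons_append]
      rw [h1] at hx
      simpa using mem_siBall_of_insert (x := x) (u := u ++ b :: a :: List.replicate t a) (v := v)
        (a := b) (by simpa using hx)
  refine le_trans (le_of_eq ?_) (Finset.card_le_card hsub)
  have hne : ∀ {l l' : List (Fin q)}, l.length ≠ l'.length → l ≠ l' :=
    fun h h' => h (congrArg _ h')
  rw [Finset.card_insert_of_notMem, Finset.card_pair]
  · exact hne (by simp)
  · simp only [Finset.mem_insert, Finset.mem_singleton, not_or]
    exact ⟨by simp [hab.symm], hne (by simp)⟩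

/-! ### Common insertions -/

/-- `x` and `y` arise from `Z 0, …, Z n` by deleting the positions `p < r`, respectively. -/
def DelPair (x y : Word q n) (Z : ℕ → Fin q) (p r : ℕ) : Prop :=
  p < r ∧ r ≤ n ∧ (∀ k : Fin n, x k = if k.1 < p then Z k else Z (k + 1)) ∧
    ∀ k : Fin n, y k = if k.1 < r then Z k else Z (k + 1)

theorem exists_delPair {x y : Word q n} (hxy : x ≠ y) {z : Word q (n + 1)}
    (hx : z ∈ insWords x) (hy : z ∈ insWords y) :
    ∃ (Z : ℕ → Fin q) (p r : ℕ), (DelPair x y Z p r ∨ DelPair y x Z p r) ∧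
      ∀ k : Fin (n + 1), z k = Z k := by
  rw [mem_insWords] at hx hy
  obtain ⟨p, hp⟩ := hx
  obtain ⟨r, hr⟩ := hy
  have hpr : p ≠ r := by
    rintro rfl
    exact hxy (funext fun k => (hp k).trans (hr k).symm)
  -- The value beyond `n` is arbitrary; a total `Z` keeps bounds out of the index arithmetic.
  set Z : ℕ → Fin q := fun k => if h : k < n + 1 then z ⟨k, h⟩ else z 0 with hZ
  have hzZ : ∀ k : Fin (n + 1), z k = Z k := by
    intro k
    simp only [hZ]
    rw [dif_pos k.2]
  have key : ∀ (w : Word q n) (p : Fin (n + 1)), (∀ k, w k = z (p.succAbove k)) →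
      ∀ k : Fin n, w k = if k.1 < p.1 then Z k else Z (k + 1) := by
    intro w p h k
    rw [h k, hzZ]
    split_ifs with hlt
    · rw [Fin.succAbove_of_castSucc_lt _ _ (by simpa [Fin.lt_def] using hlt)]
      rfl
    · rw [Fin.succAbove_of_le_castSucc _ _ (by simpa [Fin.le_def] using hlt)]
      rfl
  refine ⟨Z, min p r, max p r, ?_, hzZ⟩
  rcases lt_or_gt_of_ne hpr with h | h
  · left
    have h' : p.1 < r.1 := h
    rw [min_eq_left h'.le, max_eq_right h'.le]
    exact ⟨h', by omega, key x p hp, key y r hr⟩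
  · right
    have h' : r.1 < p.1 := h
    rw [min_eq_right h'.le, max_eq_left h'.le]
    exact ⟨h', by omega, key y r hr, key x p hp⟩

theorem DelPair.mem_of_ne {x y : Word q n} {Z : ℕ → Fin q} {p r : ℕ} (h : DelPair x y Z p r)
    {d : Fin n} (hd : x d ≠ y d) : p ≤ d.1 ∧ d.1 < r := by
  obtain ⟨h1, h2, h3, h4⟩ := h
  rw [h3, h4] at hd
  constructor
  · by_contra hlt
    rw [if_pos (by omega), if_pos (by omega)] at hd
    exact hd rfl
  · by_contra hlt
    rw [if_neg (by omega), if_neg (by omega)] at hd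
    exact hd rfl

/-- A position `d` where `x` and `y` differ lies between the deletions of both pairs. The
supersequence then reads as `y` up to `d` and as `x`, shifted by one, after it. -/
theorem DelPair.unique {x y : Word q n} (hxy : x ≠ y) {Z Z' : ℕ → Fin q} {p r p' r' : ℕ}
    (h : DelPair x y Z p r) (h' : DelPair x y Z' p' r') {k : ℕ} (hk : k ≤ n) : Z k = Z' k := by
  obtain ⟨d, hd⟩ := Function.ne_iff.1 hxy
  obtain ⟨h1, h2⟩ := h.mem_of_ne hd
  obtain ⟨h1', h2'⟩ := h'.mem_of_ne hd
  obtain ⟨-, -, h3, h4⟩ := h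
  obtain ⟨-, -, h3', h4'⟩ := h'
  have hdn := d.2
  rcases le_or_gt k d.1 with hkd | hkd
  · have e := h4 ⟨k, by omega⟩
    have e' := h4' ⟨k, by omega⟩
    rw [if_pos (by simp; omega)] at e e'
    exact e.symm.trans e'
  · obtain ⟨j, rfl⟩ : ∃ j, k = j + 1 := ⟨k - 1, by omega⟩
    have e := h3 ⟨j, by omega⟩
    have e' := h3' ⟨j, by omega⟩
    rw [if_neg (by simp; omega)] at e e'
    exact e.symm.trans e'

/-- Each of the two orientations of a deletion pair admits one supersequence at most. -/
theorem card_insWords_inter_le {x y : Word q n} (hxy : x ≠ y) :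
    (insWords x ∩ insWords y).card ≤ 2 := by
  by_contra hcon
  obtain ⟨a, b, c, ha, hb, hc, hab, hac, hbc⟩ := Finset.two_lt_card_iff.1 (not_le.1 hcon)
  rw [Finset.mem_inter] at ha hb hc
  obtain ⟨Za, pa, ra, hda, ea⟩ := exists_delPair hxy ha.1 ha.2
  obtain ⟨Zb, pb, rb, hdb, eb⟩ := exists_delPair hxy hb.1 hb.2
  obtain ⟨Zc, pc, rc, hdc, ec⟩ := exists_delPair hxy hc.1 hc.2
  have key : ∀ {z z' : Word q (n + 1)} {Z Z' : ℕ → Fin q}, (∀ k : Fin (n + 1), z k = Z k) →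
      (∀ k : Fin (n + 1), z' k = Z' k) → (∀ k ≤ n, Z k = Z' k) → z = z' := by
    intro z z' Z Z' e e' h
    funext k
    rw [e, e', h _ (by omega)]
  rcases hda with hda | hda <;> rcases hdb with hdb | hdb <;> rcases hdc with hdc | hdc
  · exact hab (key ea eb fun k hk => hda.unique hxy hdb hk)
  · exact hab (key ea eb fun k hk => hda.unique hxy hdb hk)
  · exact hac (key ea ec fun k hk => hda.unique hxy hdc hk)
  · exact hbc (key eb ec fun k hk => hdb.unique hxy.symm hdc hk)
  · exact hbc (key eb ec fun k hk => hdb.unique hxy hdc hk)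
  · exact hac (key ea ec fun k hk => hda.unique hxy.symm hdc hk)
  · exact hab (key ea eb fun k hk => hda.unique hxy.symm hdb hk)
  · exact hab (key ea eb fun k hk => hda.unique hxy.symm hdb hk)

theorem delPair_both_of_card {x y : Word q n} (hxy : x ≠ y)
    (h : 1 < (insWords x ∩ insWords y).card) :
    (∃ Z p r, DelPair x y Z p r) ∧ ∃ Z p r, DelPair y x Z p r := by
  obtain ⟨a, ha, b, hb, hab⟩ := Finset.one_lt_card.1 h
  rw [Finset.mem_inter] at ha hb
  obtain ⟨Za, pa, ra, hda, ea⟩ := exists_delPair hxy ha.1 ha.2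
  obtain ⟨Zb, pb, rb, hdb, eb⟩ := exists_delPair hxy hb.1 hb.2
  rcases hda with hda | hda <;> rcases hdb with hdb | hdb
  · refine absurd (funext fun k => ?_) hab
    rw [ea, eb, hda.unique hxy hdb (by omega)]
  · exact ⟨⟨_, _, _, hda⟩, _, _, _, hdb⟩
  · exact ⟨⟨_, _, _, hdb⟩, _, _, _, hda⟩
  · refine absurd (funext fun k => ?_) hab
    rw [ea, eb, hda.unique hxy.symm hdb (by omega)]

/-! ### Common substitutions -/

theorem eq_of_ne_of_hammingDist_le_one {x u : Word q n} (h : hammingDist x u ≤ 1) {i j : Fin n}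
    (hi : x i ≠ u i) (hj : x j ≠ u j) : i = j := by
  rw [hammingDist, Finset.card_le_one] at h
  exact h i (by simpa using hi) j (by simpa using hj)

/-- A common output that changes `x` at `i` keeps `x j`, so it changes `y` at `j` and must agree
with `y` at `i`; otherwise the roles of `x` and `y` are exchanged. -/
theorem card_subWords_inter_le_two {x y : Word q n} {i j : Fin n} (hij : i ≠ j) (hi : x i ≠ y i)
    (hj : x j ≠ y j) : (subWords x ∩ subWords y).card ≤ 2 := by
  have hsub : subWords x ∩ subWords y ⊆
      {Function.update x i (y i), Function.update y i (x i)} := by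
    intro u hu
    rw [Finset.mem_inter, mem_subWords, mem_subWords] at hu
    obtain ⟨hx, hy⟩ := hu
    rw [Finset.mem_insert, Finset.mem_singleton]
    have key : ∀ {x y : Word q n}, x j ≠ y j → hammingDist x u ≤ 1 → hammingDist y u ≤ 1 →
        x i ≠ u i → u = Function.update x i (y i) := by
      intro x y hj hx hy hxu
      funext k
      by_cases hk : k = i
      · subst hk
        rw [Function.update_self]
        by_contra hne
        have hxj : x j = u j := by
          by_contra hxj
          exact hij (eq_of_ne_of_hammingDist_le_one hx hxu hxj)
        exact hij (eq_of_ne_of_hammingDist_le_one hy (Ne.symm hne) (hxj ▸ hj.symm))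
      · rw [Function.update_of_ne hk]
        by_contra hne
        exact hk (eq_of_ne_of_hammingDist_le_one hx (Ne.symm hne) hxu)
    by_cases hxu : x i = u i
    · exact Or.inr (key hj.symm hy hx (hxu ▸ hi.symm))
    · exact Or.inl (key hj hx hy hxu)
  exact (Finset.card_le_card hsub).trans Finset.card_le_two

theorem hammingDist_le_two_of_subWords_inter {x y : Word q n}
    (h : (subWords x ∩ subWords y).Nonempty) : hammingDist x y ≤ 2 := by
  obtain ⟨u, hu⟩ := h
  rw [Finset.mem_inter, mem_subWords, mem_subWords] at hu
  have := hammingDist_triangle_right x y u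
  omega

theorem exists_of_hammingDist_le_two {x y : Word q n} (hxy : x ≠ y) (h : hammingDist x y ≤ 2) :
    (∃ i, x i ≠ y i ∧ ∀ k, k ≠ i → x k = y k) ∨
      ∃ i j, i < j ∧ x i ≠ y i ∧ x j ≠ y j ∧ ∀ k, k ≠ i → k ≠ j → x k = y k := by
  have hpos := hammingDist_pos.2 hxy
  have hcases : hammingDist x y = 1 ∨ hammingDist x y = 2 := by omega
  rcases hcases with h1 | h2
  · left
    obtain ⟨i, hi⟩ := Finset.card_eq_one.1 h1
    simp only [Finset.ext_iff, Finset.mem_filter, Finset.mem_univ, true_and,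
      Finset.mem_singleton] at hi
    exact ⟨i, (hi i).2 rfl, fun k hk => not_not.1 fun hne => hk ((hi k).1 hne)⟩
  · right
    obtain ⟨i, j, hij, hs⟩ := Finset.card_eq_two.1 h2
    simp only [Finset.ext_iff, Finset.mem_filter, Finset.mem_univ, true_and,
      Finset.mem_insert, Finset.mem_singleton] at hs
    have hrest : ∀ k, k ≠ i → k ≠ j → x k = y k := fun k h1 h2 =>
      not_not.1 fun hne => ((hs k).1 hne).elim h1 h2
    rcases lt_or_gt_of_ne hij with hlt | hlt
    · exact ⟨i, j, hlt, (hs i).2 (Or.inl rfl), (hs j).2 (Or.inr rfl), hrest⟩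
    · exact ⟨j, i, hlt, (hs j).2 (Or.inr rfl), (hs i).2 (Or.inl rfl), fun k h1 h2 => hrest k h2 h1⟩

theorem card_subWords_inter_le {x y : Word q n} (hxy : x ≠ y) (hq : 2 ≤ q) :
    (subWords x ∩ subWords y).card ≤ q := by
  rcases (subWords x ∩ subWords y).eq_empty_or_nonempty with h | h
  · simp [h]
  rcases exists_of_hammingDist_le_two hxy (hammingDist_le_two_of_subWords_inter h) with
    ⟨i, hi, hrest⟩ | ⟨i, j, hij, hi, hj, -⟩
  · have hsub : subWords x ∩ subWords y ⊆
        Finset.univ.image fun c : Fin q => Function.update x i c := by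
      intro u hu
      rw [Finset.mem_inter, mem_subWords, mem_subWords] at hu
      refine Finset.mem_image.2 ⟨u i, Finset.mem_univ _, funext fun k => ?_⟩
      by_cases hk : k = i
      · subst hk; simp
      · rw [Function.update_of_ne hk]
        by_contra hne
        by_cases hxi : x i = u i
        · exact hk (eq_of_ne_of_hammingDist_le_one hu.2 (hrest k hk ▸ hne) (hxi ▸ hi.symm))
        · exact hk (eq_of_ne_of_hammingDist_le_one hu.1 hne hxi)
    refine (Finset.card_le_card hsub).trans (Finset.card_image_le.trans ?_)
    simp
  · exact (card_subWords_inter_le_two hij.ne hi hj).trans hq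

/-- Exchanging the roles of `x` and `y` maps a common substitution output to another one. -/
theorem one_lt_card_subWords_inter {x y : Word q n} (hxy : x ≠ y)
    (h : (subWords x ∩ subWords y).Nonempty) : 1 < (subWords x ∩ subWords y).card := by
  obtain ⟨u, hu⟩ := h
  refine Finset.one_lt_card.2 ⟨u, hu, fun k => if u k = x k then y k else x k, ?_, ?_⟩
  · rw [Finset.mem_inter, mem_subWords, mem_subWords] at hu ⊢
    refine ⟨le_trans ?_ hu.2, le_trans ?_ hu.1⟩
    · refine Finset.card_le_card fun k hk => ?_
      simp only [Finset.mem_filter, Finset.mem_univ, true_and] at hk ⊢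
      split_ifs at hk with hux
      · rw [hux]; exact hk.symm
      · exact absurd rfl hk
    · refine Finset.card_le_card fun k hk => ?_
      simp only [Finset.mem_filter, Finset.mem_univ, true_and] at hk ⊢
      split_ifs at hk with hux
      · exact absurd rfl hk
      · exact Ne.symm hux
  · intro hEq
    have hx : ∀ k, u k = x k := by
      intro k
      by_contra hne
      have := congrFun hEq k
      simp only [if_neg hne] at this
      exact hne this
    refine hxy (funext fun k => ?_)
    have := congrFun hEq k
    simp only [if_pos (hx k)] at this
    rw [← hx k, this]

theorem le_card_subWords (hq : 2 ≤ q) (x : Word q n) : n ≤ (subWords x).card := by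
  have : Nontrivial (Fin q) := Fin.nontrivial_iff_two_le.2 hq
  choose c hc using fun a : Fin q => exists_ne a
  have hinj : Function.Injective fun i : Fin n => Function.update x i (c (x i)) := by
    intro i j hij
    by_contra hne
    have := congrFun hij i
    simp only [Function.update_self, Function.update_of_ne hne] at this
    exact hc _ this
  have hsub : Finset.univ.image (fun i : Fin n => Function.update x i (c (x i))) ⊆ subWords x := by
    intro u hu
    obtain ⟨i, -, rfl⟩ := Finset.mem_image.1 hu
    rw [mem_subWords, hammingDist, Finset.card_le_one]
    have : ∀ k, x k ≠ Function.update x i (c (x i)) k → k = i := by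
      intro k hk
      by_contra hne
      rw [Function.update_of_ne hne] at hk
      exact hk rfl
    intro k hk l hl
    rw [Finset.mem_filter] at hk hl
    exact (this k hk.2).trans (this l hl.2).symm
  refine le_trans (le_of_eq ?_) (Finset.card_le_card hsub)
  rw [Finset.card_image_of_injective _ hinj]
  simp

/-! ### From densities of codes to redundancies -/

theorem isReconstructionCode_iff {N : ℕ} (hN : 0 < N) {C : Finset (Word q n)} :
    IsReconstructionCode siBall N C ↔
      ∀ x ∈ C, ∀ y ∈ C, x ≠ y → (siBall x ∩ siBall y).card < N := by
  rw [IsReconstructionCode, readCoverage, Finset.sup_lt_iff (by simpa using hN)]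
  simp only [Finset.mem_offDiag, Prod.forall]
  exact ⟨fun h x hx y hy hxy => h x y ⟨hx, hy, hxy⟩, fun h x y hxy => h x hxy.1 y hxy.2.1 hxy.2.2⟩

theorem rhoSI_le_logb (hq : 2 ≤ q) {N : ℕ} (hN : 0 < N) {K : ℝ} (hK : 0 < K)
    {C : Finset (Word q n)} (hC : IsReconstructionCode siBall N C)
    (hcard : (q : ℝ) ^ n ≤ K * C.card) : rhoSI q n N ≤ Real.logb q K := by
  have hq1 : (1 : ℝ) < q := by exact_mod_cast hq
  have hqn : (0 : ℝ) < (q : ℝ) ^ n := by positivity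
  have hCpos : (0 : ℝ) < C.card := by
    by_contra h
    nlinarith [not_lt.1 h]
  have hne : C.Nonempty := Finset.card_pos.1 (by exact_mod_cast hCpos)
  have h1 : rhoSI q n N ≤ n - Real.logb q C.card :=
    (optRedundancy_isLeast siBall (by omega) hN).2 ⟨C, hne, hC, rfl⟩
  have h2 : (n : ℝ) ≤ Real.logb q K + Real.logb q C.card := by
    rw [← Real.logb_mul hK.ne' hCpos.ne', Real.le_logb_iff_rpow_le hq1 (by positivity),
      Real.rpow_natCast]
    exact hcard
  linarith

theorem logb_le_rhoSI (hq : 2 ≤ q) {N : ℕ} (hN : 0 < N) {K : ℝ} (hK : 0 < K)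
    (h : ∀ C : Finset (Word q n), IsReconstructionCode siBall N C → K * C.card ≤ (q : ℝ) ^ n) :
    Real.logb q K ≤ rhoSI q n N := by
  have hq1 : (1 : ℝ) < q := by exact_mod_cast hq
  obtain ⟨C, hne, hC, hr⟩ :=
    (optRedundancy_isLeast (siBall : Word q n → _) (N := N) (by omega) hN).1
  have hCpos : (0 : ℝ) < C.card := by exact_mod_cast hne.card_pos
  have h2 : Real.logb q K + Real.logb q C.card ≤ n := by
    rw [← Real.logb_mul hK.ne' hCpos.ne', Real.logb_le_iff_le_rpow hq1 (by positivity),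
      Real.rpow_natCast]
    exact h C hC
  rw [rhoSI, hr]
  linarith

/-- If the words of `R` with the same syndrome form a code, then some syndrome class is large. -/
theorem rhoSI_le_of_syndrome (hq : 2 ≤ q) {N : ℕ} (hN : 0 < N) {T : Type*} [Fintype T]
    [Nonempty T] (f : Word q n → T) (R : Finset (Word q n)) {c : ℝ} (hc : 0 < c)
    (hR : (q : ℝ) ^ n ≤ c * R.card)
    (h : ∀ x ∈ R, ∀ y ∈ R, x ≠ y → f x = f y → (siBall x ∩ siBall y).card < N) :
    rhoSI q n N ≤ Real.logb q (c * Fintype.card T) := by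
  classical
  have hT : (0 : ℝ) < Fintype.card T := by exact_mod_cast Fintype.card_pos
  obtain ⟨t, -, ht⟩ := Finset.exists_le_card_fiber_of_nsmul_le_card_of_maps_to
    (s := R) (t := Finset.univ) (f := f) (b := (R.card : ℝ) / Fintype.card T)
    (fun _ _ => Finset.mem_univ _) Finset.univ_nonempty (by
      rw [Finset.card_univ, nsmul_eq_mul, mul_div_cancel₀ _ hT.ne'])
  refine rhoSI_le_logb hq hN (by positivity) (C := R.filter fun x => f x = t) ?_ ?_
  · rw [isReconstructionCode_iff hN]
    intro x hx y hy hxy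
    rw [Finset.mem_filter] at hx hy
    exact h x hx.1 y hy.1 hxy (hx.2.trans hy.2.symm)
  · rw [div_le_iff₀ hT] at ht
    nlinarith

theorem rhoSI_eq_zero (hq : 2 ≤ q) {N : ℕ} (hN : q + 3 ≤ N) : rhoSI q n N = 0 := by
  have hqn : (Fintype.card (Word q n) : ℝ) = (q : ℝ) ^ n := by simp
  apply le_antisymm
  · have := rhoSI_le_of_syndrome (n := n) hq (N := N) (by omega) (fun _ => ()) Finset.univ one_pos
      (by rw [Finset.card_univ, hqn, one_mul]) (by
        intro x _ y _ hxy _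
        rw [card_siBall_inter]
        have := card_subWords_inter_le hxy hq
        have := card_insWords_inter_le hxy
        omega)
    simpa using this
  · have := logb_le_rhoSI (n := n) hq (N := N) (by omega) one_pos (by
      intro C _
      rw [one_mul, ← hqn]
      exact_mod_cast Finset.card_le_univ C)
    simpa using this

/-- Codes without pairs at Hamming distance one have redundancy at least one. -/
theorem one_le_rhoSI (hq : 2 ≤ q) (hn : 1 ≤ n) {N : ℕ} (hN0 : 0 < N) (hN : N ≤ q + 2) :
    1 ≤ rhoSI q n N := by
  have hq1 : (1 : ℝ) < q := by exact_mod_cast hq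
  obtain ⟨m, rfl⟩ : ∃ m, n = m + 1 := ⟨n - 1, by omega⟩
  rw [← Real.logb_self_eq_one hq1]
  refine logb_le_rhoSI hq hN0 (by positivity) fun C hC => ?_
  rw [isReconstructionCode_iff hN0] at hC
  -- Two codewords with the same tail would be at distance one.
  have : C.card ≤ q ^ m := by
    have hinj : Set.InjOn (Fin.tail : Word q (m + 1) → Word q m) C := by
      intro x hx y hy hxy
      by_contra hne
      have hh : x 0 ≠ y 0 := by
        intro h0
        apply hne
        rw [← Fin.cons_self_tail x, ← Fin.cons_self_tail y, hxy, h0]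
      have hform : ∀ x : Word q (m + 1), List.ofFn x = [] ++ x 0 :: List.ofFn (Fin.tail x) := by
        intro x
        rw [List.ofFn_succ]; rfl
      have := card_siBall_inter_of_subst hh (hform x) (hxy ▸ hform y)
      have := hC x hx y hy hne
      omega
    have := Finset.card_le_card_of_injOn (t := Finset.univ) _ (fun _ _ => Finset.mem_univ _) hinj
    simpa using this
  rw [pow_succ']
  gcongr
  exact_mod_cast this

theorem sum_sub_sum_eq_single {A : Type*} [AddCommGroup A] {ι : Type*} [Fintype ι]
    {f g : ι → A} {i : ι} (h : ∀ k, k ≠ i → f k = g k) :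
    ∑ k, f k - ∑ k, g k = f i - g i := by
  rw [← Finset.sum_sub_distrib]
  exact Fintype.sum_eq_single i fun k hk => by rw [h k hk, sub_self]

theorem sum_sub_sum_eq_pair {A : Type*} [AddCommGroup A] {ι : Type*} [Fintype ι]
    {f g : ι → A} {i j : ι} (hij : i ≠ j) (h : ∀ k, k ≠ i → k ≠ j → f k = g k) :
    ∑ k, f k - ∑ k, g k = (f i - g i) + (f j - g j) := by
  rw [← Finset.sum_sub_distrib]
  exact Fintype.sum_eq_add i j hij fun k hk => by rw [h k hk.1 hk.2, sub_self]

theorem exists_two_of_sum_eq [NeZero q] {x y : Word q n} (hxy : x ≠ y)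
    (h : ∑ k, x k = ∑ k, y k) : ∃ i j, i ≠ j ∧ x i ≠ y i ∧ x j ≠ y j := by
  obtain ⟨i, hi⟩ := Function.ne_iff.1 hxy
  by_contra hcon
  have := sum_sub_sum_eq_single (f := x) (g := y) (i := i) fun k hk => by
    by_contra hne
    exact hcon ⟨i, k, hk.symm, hi, hne⟩
  rw [h, sub_self, eq_comm, sub_eq_zero] at this
  exact hi this

theorem rhoSI_eq_one (hq : 2 ≤ q) (hn : 1 ≤ n) {N : ℕ} (hN : 5 ≤ N) (hN' : N ≤ q + 2) :
    rhoSI q n N = 1 := by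
  have hq1 : (1 : ℝ) < q := by exact_mod_cast hq
  have : NeZero q := ⟨by omega⟩
  refine le_antisymm ?_ (one_le_rhoSI hq hn (by omega) hN')
  -- The sum in `Fin q` excludes distance one, which leaves at most `2 + 2` common outputs.
  have := rhoSI_le_of_syndrome (n := n) hq (N := N) (by omega) (fun x => ∑ k, x k) Finset.univ
    one_pos (by simp) (by
      intro x _ y _ hxy h
      obtain ⟨i, j, hij, hi, hj⟩ := exists_two_of_sum_eq hxy h
      rw [card_siBall_inter]
      have := card_subWords_inter_le_two hij hi hj
      have := card_insWords_inter_le hxy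
      omega)
  rwa [Fintype.card_fin, one_mul, Real.logb_self_eq_one hq1] at this

/-! ### Four reads: excluding adjacent transpositions -/

/-- Words at distance two with two common insertions differ by an adjacent transposition. -/
theorem DelPair.adjacent {x y : Word q n} {Z Z' : ℕ → Fin q} {p r p' r' : ℕ}
    (h : DelPair x y Z p r) (h' : DelPair y x Z' p' r') {i j : Fin n} (hij : i < j)
    (hi : x i ≠ y i) (hj : x j ≠ y j) (hrest : ∀ k, k ≠ i → k ≠ j → x k = y k) :
    j.1 = i.1 + 1 := by
  by_contra hne
  have hlt : i.1 < j.1 := hij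
  have hjn := j.2
  obtain ⟨a1, a2⟩ := h.mem_of_ne hi
  obtain ⟨a3, a4⟩ := h.mem_of_ne hj
  obtain ⟨b1, b2⟩ := h'.mem_of_ne hi.symm
  obtain ⟨b3, b4⟩ := h'.mem_of_ne hj.symm
  obtain ⟨-, -, h3, h4⟩ := h
  obtain ⟨-, -, h3', h4'⟩ := h'
  -- If `i + 1 < j`, the words agree at `i + 1`, while each orientation identifies the letter of one
  -- word at `i` with that of the other at `i + 1`.
  set m : Fin n := ⟨i.1 + 1, by omega⟩ with hm
  have e1 : x i = y m := by
    rw [h3, h4, if_neg (by omega), if_pos (by simp [hm]; omega)]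
  have e2 : y i = x m := by
    rw [h3', h4', if_neg (by omega), if_pos (by simp [hm]; omega)]
  have e3 : x m = y m := hrest m (by simp [hm, Fin.ext_iff]) (by simp [hm, Fin.ext_iff]; omega)
  exact hi (by rw [e1, e2, e3])

theorem rhoSI_four_le_two (hq : 2 ≤ q) : rhoSI q n 4 ≤ 2 := by
  have hq1 : (1 : ℝ) < q := by exact_mod_cast hq
  have : NeZero q := ⟨by omega⟩
  have := rhoSI_le_of_syndrome (n := n) hq (N := 4) (by omega)
    -- The first check excludes distance one. An adjacent transposition changes exactly one even
    -- position, which the second check detects.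
    (fun x => (∑ k, x k, ∑ k, if Even k.1 then x k else 0)) Finset.univ
    one_pos (by simp) (by
      intro x _ y _ hxy h
      rw [Prod.mk.injEq] at h
      obtain ⟨h1, h2⟩ := h
      obtain ⟨i, j, hij, hi, hj⟩ := exists_two_of_sum_eq hxy h1
      have hS := card_subWords_inter_le_two hij hi hj
      have hI := card_insWords_inter_le hxy
      rw [card_siBall_inter]
      by_contra hcon
      have hdist : hammingDist x y ≤ 2 :=
        hammingDist_le_two_of_subWords_inter (Finset.card_pos.1 (by omega))
      obtain ⟨⟨Z, p, r, hd⟩, Z', p', r', hd'⟩ := delPair_both_of_card hxy (by omega)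
      rcases exists_of_hammingDist_le_two hxy hdist with
        ⟨i', -, hrest⟩ | ⟨i', j', hij', hi', hj', hrest⟩
      · have := fun k (hk : x k ≠ y k) => not_not.1 fun hne => hk (hrest k hne)
        exact hij ((this i hi).trans (this j hj).symm)
      · have hadj := hd.adjacent hd' hij' hi' hj' hrest
        have := sum_sub_sum_eq_pair (f := fun k => if Even k.1 then x k else 0)
          (g := fun k => if Even k.1 then y k else 0) hij'.ne (by
            intro k h1 h2
            simp only [hrest k h1 h2])
        rw [h2, sub_self] at this
        by_cases he : Even i'.1
        · have ho : ¬ Even j'.1 := by rw [hadj]; simpa [parity_simps] using he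
          simp only [he, ho, if_true, if_false, sub_self, add_zero] at this
          exact hi' (sub_eq_zero.1 this.symm)
        · have ho : Even j'.1 := by rw [hadj]; simpa [parity_simps] using he
          simp only [he, ho, if_true, if_false, sub_self, zero_add] at this
          exact hj' (sub_eq_zero.1 this.symm))
  rw [Fintype.card_prod, Fintype.card_fin, one_mul, Nat.cast_mul, ← sq, Real.logb_pow,
    Real.logb_self_eq_one hq1] at this
  simpa using this

/-! ### Union bound over windows -/

/-- The number of words that have a window of length `B` whose letters all lie in `t`. -/
theorem card_window_mul_le (t : Finset (Fin q)) {B : ℕ} (hB : 1 ≤ B) {W : Finset (Word q n)}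
    (hW : ∀ x ∈ W, ∃ s, s + B ≤ n ∧ ∀ k : Fin n, s ≤ k.1 → k.1 < s + B → x k ∈ t) :
    W.card * q ^ B ≤ n * t.card ^ B * q ^ n := by
  rcases lt_or_ge n B with hn | hn
  · have : W = ∅ := by
      refine Finset.eq_empty_of_forall_notMem fun x hx => ?_
      obtain ⟨s, hs, -⟩ := hW x hx
      omega
    simp [this]
  set S : ℕ → Finset (Word q n) := fun s =>
    Fintype.piFinset fun k : Fin n => if s ≤ k.1 ∧ k.1 < s + B then t else Finset.univ with hS
  have hcard : ∀ s, s + B ≤ n → (S s).card = t.card ^ B * q ^ (n - B) := by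
    intro s hs
    rw [hS, Fintype.card_piFinset]
    have h1 : ∀ k : Fin n, (if s ≤ k.1 ∧ k.1 < s + B then t else Finset.univ).card =
        (fun j => if s ≤ j ∧ j < s + B then t.card else q) k.1 := by
      intro k
      dsimp only
      split_ifs <;> simp
    rw [Finset.prod_congr rfl fun k _ => h1 k,
      Fin.prod_univ_eq_prod_range (fun j => if s ≤ j ∧ j < s + B then t.card else q) n,
      Finset.prod_ite, Finset.prod_const, Finset.prod_const]
    have h2 : (Finset.range n).filter (fun j => s ≤ j ∧ j < s + B) = Finset.Ico s (s + B) := by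
      ext j
      simp
      omega
    have h3 := Finset.card_filter_add_card_filter_not (s := Finset.range n)
      (fun j => s ≤ j ∧ j < s + B)
    rw [h2, Nat.card_Ico, Finset.card_range] at h3
    rw [h2, Nat.card_Ico]
    congr 2 <;> omega
  have hsub : W ⊆ (Finset.range (n + 1 - B)).biUnion S := by
    intro x hx
    obtain ⟨s, hs, h⟩ := hW x hx
    rw [Finset.mem_biUnion]
    refine ⟨s, Finset.mem_range.2 (by omega), Fintype.mem_piFinset.2 fun k => ?_⟩
    split_ifs with hk
    · exact h k hk.1 hk.2
    · exact Finset.mem_univ _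
  have hle : ((Finset.range (n + 1 - B)).biUnion S).card ≤ n * (t.card ^ B * q ^ (n - B)) := by
    refine (Finset.card_biUnion_le_card_mul _ _ (t.card ^ B * q ^ (n - B)) ?_).trans ?_
    · intro s hs
      rw [Finset.mem_range] at hs
      exact (hcard s (by omega)).le
    · rw [Finset.card_range]
      gcongr
      omega
  calc _ ≤ n * (t.card ^ B * q ^ (n - B)) * q ^ B :=
        Nat.mul_le_mul_right _ ((Finset.card_le_card hsub).trans hle)
    _ = n * t.card ^ B * q ^ n := by
        rw [← Nat.sub_add_cancel hn, pow_add]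
        simp
        ring

/-! ### Weights and moments of deletion pairs -/

theorem DelPair.weighted_sum_sub {x y : Word q n} {Z : ℕ → Fin q} {p r : ℕ}
    (h : DelPair x y Z p r) (w : ℕ → ℤ) (g : Fin q → ℤ) :
    ∑ k : Fin n, w k * g (x k) - ∑ k : Fin n, w k * g (y k) =
      ∑ k ∈ Finset.Ico p r, w k * (g (Z (k + 1)) - g (Z k)) := by
  obtain ⟨h1, h2, h3, h4⟩ := h
  rw [← Finset.sum_sub_distrib]
  have key : ∀ k : Fin n, w k * g (x k) - w k * g (y k) =
      (fun k => if p ≤ k ∧ k < r then w k * (g (Z (k + 1)) - g (Z k)) else 0) k.1 := by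
    intro k
    rw [h3, h4]
    dsimp only
    rcases lt_or_ge k.1 p with hp | hp
    · rw [if_pos hp, if_pos (by omega), if_neg (by omega), sub_self]
    · rcases lt_or_ge k.1 r with hr | hr
      · rw [if_neg (by omega), if_pos hr, if_pos ⟨hp, hr⟩, mul_sub]
      · rw [if_neg (by omega), if_neg (by omega), if_neg (by omega), sub_self]
  rw [Finset.sum_congr rfl fun k _ => key k, Fin.sum_univ_eq_sum_range
    (fun k => if p ≤ k ∧ k < r then w k * (g (Z (k + 1)) - g (Z k)) else 0) n,
    ← Finset.sum_filter]
  congr 1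
  ext k
  simp
  omega

theorem DelPair.sum_sub {x y : Word q n} {Z : ℕ → Fin q} {p r : ℕ}
    (h : DelPair x y Z p r) (g : Fin q → ℤ) :
    ∑ k : Fin n, g (x k) - ∑ k : Fin n, g (y k) = g (Z r) - g (Z p) := by
  have := h.weighted_sum_sub (fun _ => 1) g
  simp only [one_mul] at this
  rw [this, Finset.sum_Ico_eq_sub _ h.1.le, Finset.sum_range_sub (fun k => g (Z k)),
    Finset.sum_range_sub (fun k => g (Z k))]
  ring

/-- Summation by parts removes the position weights; each remaining term compares a letter with the
boundary letter, so signs can be controlled. -/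
theorem DelPair.moment_sub {x y : Word q n} {Z : ℕ → Fin q} {p r : ℕ}
    (h : DelPair x y Z p r) (g : Fin q → ℤ) (hpr : g (Z p) = g (Z r)) :
    ∑ k : Fin n, (k.1 : ℤ) * g (x k) - ∑ k : Fin n, (k.1 : ℤ) * g (y k) =
      ∑ k ∈ Finset.Ico p r, (g (Z r) - g (Z (k + 1))) := by
  rw [h.weighted_sum_sub (fun k => (k : ℤ)) g]
  have abel : ∀ r, p ≤ r → ∑ k ∈ Finset.Ico p r, (k : ℤ) * (g (Z (k + 1)) - g (Z k)) =
      r * g (Z r) - p * g (Z p) - ∑ k ∈ Finset.Ico p r, g (Z (k + 1)) := by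
    intro r hr
    induction r, hr using Nat.le_induction with
    | base => simp
    | succ r hr ih =>
      rw [Finset.sum_Ico_succ_top hr, Finset.sum_Ico_succ_top hr, ih]
      push_cast
      ring
  rw [abel r h.1.le, Finset.sum_sub_distrib, Finset.sum_const, Nat.card_Ico, hpr, nsmul_eq_mul,
    Nat.cast_sub h.1.le]
  ring

theorem eq_of_intCast_eq {M : ℕ} {a b : ℤ} (h : (a : ZMod M) = b) (hab : |a - b| < M) : a = b := by
  have h1 : (M : ℤ) ∣ a - b := (ZMod.intCast_eq_intCast_iff_dvd_sub b a M).1 h.symm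
  exact sub_eq_zero.1 (Int.eq_zero_of_abs_lt_dvd h1 hab)

/-- The weight and the first moment of a word, to two moduli. -/
def syndrome (g : Fin q → ℤ) (M₀ M₁ : ℕ) (x : Word q n) : ZMod M₀ × ZMod M₁ :=
  (((∑ k, g (x k) : ℤ) : ZMod M₀), ((∑ k, (k.1 : ℤ) * g (x k) : ℤ) : ZMod M₁))

theorem abs_sub_le_of_mem {g : Fin q → ℤ} {H : ℕ} (h0 : ∀ c, 0 ≤ g c) (hH : ∀ c, g c ≤ H)
    (a b : Fin q) : |g a - g b| ≤ H := by
  rw [abs_le]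
  constructor <;> linarith [h0 a, h0 b, hH a, hH b]

/-- The weight detects one substitution, and the moment separates two substitutions whose
positions are at distance `L` at most. -/
theorem exists_far_of_syndrome_eq {g : Fin q → ℤ} (hg : Function.Injective g) {H L M₁ : ℕ}
    (h0 : ∀ c, 0 ≤ g c) (hH : ∀ c, g c ≤ H) (hM : L * H < M₁) {x y : Word q n} (hxy : x ≠ y)
    (h : syndrome g (2 * H + 1) M₁ x = syndrome g (2 * H + 1) M₁ y) (hd : hammingDist x y ≤ 2) :
    ∃ i j : Fin n, i < j ∧ x i ≠ y i ∧ x j ≠ y j ∧ (∀ k, k ≠ i → k ≠ j → x k = y k) ∧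
      i.1 + L < j.1 := by
  rw [syndrome, syndrome, Prod.mk.injEq] at h
  obtain ⟨hS, hT⟩ := h
  have hb := abs_sub_le_of_mem h0 hH
  rcases exists_of_hammingDist_le_two hxy hd with ⟨i, hi, hrest⟩ | ⟨i, j, hij, hi, hj, hrest⟩
  · exfalso
    have e := sum_sub_sum_eq_single (f := fun k => g (x k)) (g := fun k => g (y k)) (i := i)
      fun k hk => by simp only [hrest k hk]
    have := eq_of_intCast_eq hS (by rw [e]; push_cast; linarith [hb (x i) (y i)])
    rw [this, sub_self, eq_comm, sub_eq_zero] at e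
    exact hi (hg e)
  · refine ⟨i, j, hij, hi, hj, hrest, ?_⟩
    by_contra hfar
    have hlt : i.1 < j.1 := hij
    have e := sum_sub_sum_eq_pair (f := fun k => g (x k)) (g := fun k => g (y k)) hij.ne
      fun k h1 h2 => by simp only [hrest k h1 h2]
    have e' := sum_sub_sum_eq_pair (f := fun k : Fin n => (k.1 : ℤ) * g (x k))
      (g := fun k : Fin n => (k.1 : ℤ) * g (y k)) hij.ne
      fun k h1 h2 => by simp only [hrest k h1 h2]
    -- Two substitutions change the weight by at most `2 * H`, whence the modulus `2 * H + 1`.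
    have := eq_of_intCast_eq hS (by
      rw [e]; push_cast
      linarith [hb (x i) (y i), hb (x j) (y j), abs_add_le (g (x i) - g (y i)) (g (x j) - g (y j))])
    rw [this, sub_self] at e
    have hδ : g (x j) - g (y j) = -(g (x i) - g (y i)) := by linarith
    -- The two weight changes are opposite, so the moment changes by one of them times `j - i`.
    have e2 : (i.1 : ℤ) * g (x i) - i.1 * g (y i) + (j.1 * g (x j) - j.1 * g (y j)) =
        -(((j.1 : ℤ) - i.1) * (g (x i) - g (y i))) := by
      linear_combination (j.1 : ℤ) * hδ
    rw [e2] at e'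
    have habs : |((j.1 : ℤ) - i.1) * (g (x i) - g (y i))| ≤ L * H := by
      rw [abs_mul]
      refine mul_le_mul ?_ (hb _ _) (abs_nonneg _) (by positivity)
      rw [abs_le]
      omega
    have hz := eq_of_intCast_eq hT (by
      rw [e', abs_neg]
      exact lt_of_le_of_lt habs (by exact_mod_cast hM))
    rw [hz, sub_self, eq_comm, neg_eq_zero, mul_eq_zero] at e'
    rcases e' with e' | e'
    · omega
    · exact hi (hg (sub_eq_zero.1 e'))

/-- A syndrome class is a single-edit code as soon as the moment separates words with a common
insertion. -/
theorem rhoSI_le_of_moment (hq : 2 ≤ q) {N : ℕ} (hN : 0 < N) {g : Fin q → ℤ}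
    (hg : Function.Injective g) {H : ℕ} (h0 : ∀ c, 0 ≤ g c) (hH : ∀ c, g c ≤ H)
    (R : Finset (Word q n)) {c : ℝ} (hc : 0 < c) (hR : (q : ℝ) ^ n ≤ c * R.card)
    (hmom : ∀ x ∈ R, ∀ y ∈ R, ∀ Z p r, DelPair x y Z p r → x ≠ y → Z p = Z r →
      ∑ k ∈ Finset.Ico p r, (g (Z r) - g (Z (k + 1))) ≠ 0) :
    rhoSI q n N ≤ Real.logb q (c * ((2 * H + 1) * (n * H + 1))) := by
  have hdel : ∀ x ∈ R, ∀ y ∈ R, x ≠ y →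
      syndrome g (2 * H + 1) (n * H + 1) x = syndrome g (2 * H + 1) (n * H + 1) y →
      ∀ Z p r, ¬ DelPair x y Z p r := by
    intro x hx y hy hxy hs Z p r hd
    rw [syndrome, syndrome, Prod.mk.injEq] at hs
    obtain ⟨hS, hT⟩ := hs
    have e := hd.sum_sub g
    have hb := abs_sub_le_of_mem h0 hH
    have := eq_of_intCast_eq hS (by rw [e]; push_cast; linarith [hb (Z r) (Z p)])
    rw [this, sub_self, eq_comm, sub_eq_zero] at e
    have e' := hd.moment_sub g e.symm
    refine hmom x hx y hy Z p r hd hxy (hg e.symm) ?_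
    -- At most `n` terms of absolute value at most `H`: the modulus `n * H + 1` sees the exact
    -- value.
    have hz := eq_of_intCast_eq hT (by
      rw [e']
      refine lt_of_le_of_lt (Finset.abs_sum_le_sum_abs _ _) ?_
      refine lt_of_le_of_lt (Finset.sum_le_card_nsmul _ _ (H : ℤ) fun k _ => hb _ _) ?_
      rw [Nat.card_Ico, nsmul_eq_mul]
      have : r - p ≤ n := by have := hd.2.1; omega
      have : ((r - p : ℕ) : ℤ) * H ≤ n * H := by gcongr
      push_cast at this ⊢
      linarith)
    rw [← e', hz, sub_self]
  have := rhoSI_le_of_syndrome hq hN (syndrome g (2 * H + 1) (n * H + 1)) R hc hR (by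
    intro x hx y hy hxy hs
    have h1 : (insWords x ∩ insWords y) = ∅ := by
      refine Finset.eq_empty_of_forall_notMem fun z hz => ?_
      rw [Finset.mem_inter] at hz
      obtain ⟨Z, p, r, hd | hd, -⟩ := exists_delPair hxy hz.1 hz.2
      · exact hdel x hx y hy hxy hs Z p r hd
      · exact hdel y hy x hx hxy.symm hs.symm Z p r hd
    have h2 : (subWords x ∩ subWords y) = ∅ := by
      rw [← Finset.not_nonempty_iff_eq_empty]
      intro hne
      -- With `L = n` no two positions are far enough apart.
      obtain ⟨i, j, -, -, -, -, hfar⟩ := exists_far_of_syndrome_eq hg (L := n) h0 hH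
        (Nat.lt_succ_self _) hxy hs (hammingDist_le_two_of_subWords_inter hne)
      have := j.2
      omega
    rw [card_siBall_inter, h1, h2]
    simpa using hN)
  rw [Fintype.card_prod, ZMod.card, ZMod.card] at this
  push_cast at this
  exact this

/-- Two deletions from the same run give the same word. -/
theorem DelPair.eq_of_forall_eq {x y : Word q n} {Z : ℕ → Fin q} {p r : ℕ}
    (h : DelPair x y Z p r) (hpr : Z p = Z r)
    (hconst : ∀ k ∈ Finset.Ico p r, Z (k + 1) = Z r) : x = y := by
  obtain ⟨h1, h2, h3, h4⟩ := h
  have hZ : ∀ k, p ≤ k → k ≤ r → Z k = Z r := by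
    intro k hk hk'
    rcases hk.eq_or_lt with rfl | hlt
    · exact hpr
    · obtain ⟨j, rfl⟩ : ∃ j, k = j + 1 := ⟨k - 1, by omega⟩
      exact hconst j (Finset.mem_Ico.2 ⟨by omega, by omega⟩)
  funext k
  rw [h3, h4]
  rcases lt_or_ge k.1 p with hp | hp
  · rw [if_pos hp, if_pos (by omega)]
  · rcases lt_or_ge k.1 r with hr | hr
    · rw [if_neg (by omega), if_pos hr, hZ _ (by omega) (by omega), hZ k (by omega) (by omega)]
    · rw [if_neg (by omega), if_neg (by omega)]

/-- If no letter exceeds the boundary letter, or none is below it, the moment vanishes only for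
equal words. -/
theorem DelPair.eq_of_moment_eq_zero {x y : Word q n} {Z : ℕ → Fin q} {p r : ℕ}
    (h : DelPair x y Z p r) {g : Fin q → ℤ} (hg : Function.Injective g) (hpr : Z p = Z r)
    (hsign : (∀ k ∈ Finset.Ico p r, g (Z (k + 1)) ≤ g (Z r)) ∨
      ∀ k ∈ Finset.Ico p r, g (Z r) ≤ g (Z (k + 1)))
    (h0 : ∑ k ∈ Finset.Ico p r, (g (Z r) - g (Z (k + 1))) = 0) : x = y := by
  refine h.eq_of_forall_eq hpr fun k hk => hg ?_
  rcases hsign with hs | hs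
  · have := (Finset.sum_eq_zero_iff_of_nonneg fun k hk => sub_nonneg.2 (hs k hk)).1 h0 k hk
    linarith
  · have := (Finset.sum_eq_zero_iff_of_nonpos fun k hk => sub_nonpos.2 (hs k hk)).1 h0 k hk
    linarith

/-! ### Single-edit codes -/

/-- Over two letters every boundary letter is extreme, so the terms of the moment sum share a sign.
-/
theorem rhoSI_two_le {N : ℕ} (hN : 0 < N) :
    rhoSI 2 n N ≤ Real.logb 2 (3 * (n + 1)) := by
  have hg : Function.Injective fun c : Fin 2 => (c.1 : ℤ) := fun a b h => by
    simpa [Fin.ext_iff] using h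
  have := rhoSI_le_of_moment (n := n) le_rfl hN hg (H := 1) (by simp)
    (by intro c; have := c.2; push_cast; omega) Finset.univ one_pos (by simp) (by
      intro x _ y _ Z p r hd hxy hpr h0
      refine hxy (hd.eq_of_moment_eq_zero hg hpr ?_ h0)
      by_cases hr : (Z r).1 = 0
      · right; intro k _; simp [hr]
      · left; intro k _; have := (Z r).2; have := (Z (k + 1)).2; omega)
  norm_num at this ⊢
  exact this

/-- Every segment sums to at least `-(B * b)`: a segment longer than `B` ends in a window with a
large term, which contributes at least `(G - B) * b ≥ 0` and can be cut off. The two segments around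
the given large term lose at most `2 * B * b < (G - 1) * b`. -/
theorem sum_Ico_pos_of_dense {h : ℕ → ℤ} {b : ℤ} (hb : 0 < b) {G B p r : ℕ} (hGB : 2 * B + 1 < G)
    (hlow : ∀ k, -b ≤ h k)
    (hwin : ∀ s, p ≤ s → s + B ≤ r → ∃ k, s ≤ k ∧ k < s + B ∧ (G - 1) * b ≤ h k)
    (hbig : ∃ k, p ≤ k ∧ k < r ∧ (G - 1) * b ≤ h k) : 0 < ∑ k ∈ Finset.Ico p r, h k := by
  have hsum : ∀ s e, ∑ k ∈ Finset.Ico s e, h k =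
      ∑ k ∈ Finset.Ico s e, (h k + b) - ((e - s : ℕ) : ℤ) * b := by
    intro s e
    rw [Finset.sum_add_distrib, Finset.sum_const, Nat.card_Ico, nsmul_eq_mul]
    ring
  have hnn : ∀ s e, 0 ≤ ∑ k ∈ Finset.Ico s e, (h k + b) :=
    fun s e => Finset.sum_nonneg fun k _ => by linarith [hlow k]
  have hGB' : (2 * B + 1 : ℤ) < G := by exact_mod_cast hGB
  have key : ∀ d s, p ≤ s → s + d ≤ r → -(B * b) ≤ ∑ k ∈ Finset.Ico s (s + d), h k := by
    intro d
    induction d using Nat.strong_induction_on with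
    | _ d ih =>
      intro s hs hsd
      rcases lt_or_ge B d with hd | hd
      · rcases Nat.eq_zero_or_pos B with hB | hB
        · obtain ⟨k, h1, h2, -⟩ := hwin s hs (by omega)
          omega
        obtain ⟨k, h1, h2, h3⟩ := hwin (s + (d - B)) (by omega) (by omega)
        have h4 := ih (d - B) (by omega) s hs (by omega)
        have h5 := Finset.single_le_sum (f := fun k => h k + b)
          (s := Finset.Ico (s + (d - B)) (s + d))
          (fun k _ => by linarith [hlow k]) (Finset.mem_Ico.2 ⟨h1, by omega⟩)
        rw [← Finset.sum_Ico_consecutive h (m := s) (n := s + (d - B)) (k := s + d) (by omega)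
          (by omega), hsum (s + (d - B))]
        have h6 : s + d - (s + (d - B)) = B := by omega
        rw [h6]
        nlinarith
      · rw [hsum]
        have h6 : s + d - s = d := by omega
        rw [h6]
        have := hnn s (s + d)
        have : (d : ℤ) * b ≤ B * b := by gcongr
        linarith
  obtain ⟨k, h1, h2, h3⟩ := hbig
  have e1 := key (k - p) p le_rfl (by omega)
  have e2 := key (r - (k + 1)) (k + 1) (by omega) (by omega)
  rw [Nat.add_sub_cancel' h1] at e1
  rw [Nat.add_sub_cancel' (by omega : k + 1 ≤ r)] at e2
  rw [← Finset.sum_Ico_consecutive h h1 h2.le, Finset.sum_eq_sum_Ico_succ_bot h2]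
  nlinarith

/-- If no letter exceeds the boundary letter, the moment terms share a sign. Otherwise the boundary
letter is not the largest one, so every window has a letter above it; with the base `2 * B + 2`
these outweigh all smaller letters. -/
theorem rhoSI_le_of_dense (hq : 2 ≤ q) {N : ℕ} (hN : 0 < N) {B : ℕ} (R : Finset (Word q n))
    {c : ℝ} (hc : 0 < c) (hcR : (q : ℝ) ^ n ≤ c * R.card)
    (hR : ∀ x ∈ R, ∀ s, s + B ≤ n → ∃ k : Fin n, s ≤ k.1 ∧ k.1 < s + B ∧ (x k).1 = q - 1) :
    rhoSI q n N ≤ Real.logb q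
      (c * ((2 * ((2 * B + 2 : ℕ) ^ q : ℕ) + 1) * (n * ((2 * B + 2 : ℕ) ^ q : ℕ) + 1))) := by
  set G : ℕ := 2 * B + 2 with hG
  have hG1 : (1 : ℤ) < G := by rw [hG]; push_cast; omega
  have hmono : StrictMono fun c : ℕ => (G : ℤ) ^ c := pow_right_strictMono₀ hG1
  have hg : Function.Injective fun c : Fin q => (G : ℤ) ^ c.1 :=
    hmono.injective.comp Fin.val_injective
  refine rhoSI_le_of_moment hq hN hg (fun c => by positivity) ?_ R hc hcR ?_
  · intro c
    push_cast
    exact hmono.monotone c.2.le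
  · intro x hx y hy Z p r hd hxy hpr h0
    by_cases hsign : ∀ k ∈ Finset.Ico p r, (Z (k + 1)).1 ≤ (Z r).1
    · exact hxy (hd.eq_of_moment_eq_zero hg hpr
        (Or.inl fun k hk => hmono.monotone (hsign k hk)) h0)
    push Not at hsign
    obtain ⟨k₀, hk₀, hlt⟩ := hsign
    rw [Finset.mem_Ico] at hk₀
    have hbig : ∀ k, (Z r).1 < (Z (k + 1)).1 →
        ((G : ℤ) - 1) * (G : ℤ) ^ (Z r).1 ≤ (G : ℤ) ^ (Z (k + 1)).1 - (G : ℤ) ^ (Z r).1 := by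
      intro k hk
      have : (G : ℤ) ^ ((Z r).1 + 1) ≤ (G : ℤ) ^ (Z (k + 1)).1 := hmono.monotone hk
      rw [pow_succ] at this
      linarith
    have := sum_Ico_pos_of_dense
      (h := fun k => (G : ℤ) ^ (Z (k + 1)).1 - (G : ℤ) ^ (Z r).1) (b := (G : ℤ) ^ (Z r).1)
      (p := p) (r := r) (G := G) (B := B) (by positivity) (by omega)
      (fun k => by
        have : (0 : ℤ) ≤ (G : ℤ) ^ (Z (k + 1)).1 := by positivity
        linarith) (by
        intro s hs hsr
        have hrn := hd.2.1
        obtain ⟨k, h1, h2, h3⟩ := hR x hx s (by omega)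
        refine ⟨k, h1, h2, hbig k ?_⟩
        -- `x` lacks the earlier position `p`, so from there on its letter at `k` is `Z (k + 1)`,
        -- the one in the sum.
        have e := hd.2.2.1 k
        rw [if_neg (by omega)] at e
        rw [← e, h3]
        have := (Z (k₀ + 1)).2
        omega)
      ⟨k₀, hk₀.1, hk₀.2, hbig k₀ hlt⟩
    have h0' : ∑ k ∈ Finset.Ico p r, ((G : ℤ) ^ (Z (k + 1)).1 - (G : ℤ) ^ (Z r).1) = 0 := by
      rw [← neg_eq_zero, ← Finset.sum_neg_distrib, ← h0]
      exact Finset.sum_congr rfl fun k _ => by ring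
    linarith

/-! ### Typical words -/

/-- Bernoulli's inequality. Consequently a window of length `q * L` misses a given letter with
probability at most `2 ^ (-L)`. -/
theorem two_mul_pow_le (hq : 2 ≤ q) : 2 * (q - 1) ^ q ≤ q ^ q := by
  obtain ⟨m, rfl⟩ : ∃ m, q = m + 1 := ⟨q - 1, by omega⟩
  have hm : (0 : ℝ) < m := by exact_mod_cast (by omega : 0 < m)
  have h1 := one_add_mul_le_pow (a := (1 / m : ℝ)) (by have := one_div_pos.2 hm; linarith) (m + 1)
  have h2 : (2 : ℝ) ≤ 1 + ((m + 1 : ℕ) : ℝ) * (1 / m) := by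
    have : ((m + 1 : ℕ) : ℝ) * (1 / m) = 1 + 1 / m := by
      push_cast; field_simp
    have := one_div_pos.2 hm
    linarith
  have h3 : ((m : ℝ) + 1) ^ (m + 1) = (1 + 1 / m) ^ (m + 1) * (m : ℝ) ^ (m + 1) := by
    rw [← mul_pow]
    congr 1
    field_simp
  have h4 : (2 : ℝ) * (m : ℝ) ^ (m + 1) ≤ ((m : ℝ) + 1) ^ (m + 1) := by
    rw [h3]
    gcongr
    linarith
  rw [Nat.add_sub_cancel]
  exact_mod_cast h4

theorem pow_le_two_mul_card_compl {W : Finset (Word q n)} [DecidableEq (Word q n)]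
    (hW : 2 * W.card ≤ q ^ n) : (q : ℝ) ^ n ≤ 2 * (Wᶜ).card := by
  have h := Finset.card_add_card_compl W
  rw [Fintype.card_fun, Fintype.card_fin, Fintype.card_fin] at h
  have : q ^ n ≤ 2 * (Wᶜ).card := by omega
  exact_mod_cast this

/-- In at least half of the words, the largest letter occurs in every window of logarithmic
length. -/
theorem exists_dense_words (hq : 2 ≤ q) (hn : 1 ≤ n) :
    ∃ R : Finset (Word q n), (q : ℝ) ^ n ≤ 2 * R.card ∧
      ∀ x ∈ R, ∀ s, s + q * Nat.clog 2 (2 * n) ≤ n →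
        ∃ k : Fin n, s ≤ k.1 ∧ k.1 < s + q * Nat.clog 2 (2 * n) ∧ (x k).1 = q - 1 := by
  classical
  set L := Nat.clog 2 (2 * n) with hL
  have hL1 : 1 ≤ L := Nat.clog_pos one_lt_two (by omega)
  have hLn : 2 * n ≤ 2 ^ L := Nat.le_pow_clog one_lt_two _
  set W : Finset (Word q n) := Finset.univ.filter fun x =>
    ∃ s, s + q * L ≤ n ∧ ∀ k : Fin n, s ≤ k.1 → k.1 < s + q * L →
      x k ∈ Finset.univ.erase (⟨q - 1, by omega⟩ : Fin q) with hW
  refine ⟨Wᶜ, pow_le_two_mul_card_compl ?_, ?_⟩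
  · have h1 := card_window_mul_le (Finset.univ.erase (⟨q - 1, by omega⟩ : Fin q)) (B := q * L)
      (W := W) (Nat.mul_pos (by omega) hL1) (fun x hx => (Finset.mem_filter.1 hx).2)
    rw [Finset.card_erase_of_mem (Finset.mem_univ _), Finset.card_univ, Fintype.card_fin] at h1
    have h2 : 2 * n * (q - 1) ^ (q * L) ≤ q ^ (q * L) := by
      calc 2 * n * (q - 1) ^ (q * L) ≤ 2 ^ L * (q - 1) ^ (q * L) := Nat.mul_le_mul_right _ hLn
        _ = (2 * (q - 1) ^ q) ^ L := by rw [mul_pow, pow_mul]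
        _ ≤ (q ^ q) ^ L := Nat.pow_le_pow_left (two_mul_pow_le hq) _
        _ = q ^ (q * L) := (pow_mul _ _ _).symm
    have h3 : 0 < n * (q - 1) ^ (q * L) := Nat.mul_pos (by omega) (pow_pos (by omega) _)
    refine Nat.le_of_mul_le_mul_right ?_ h3
    calc 2 * W.card * (n * (q - 1) ^ (q * L)) = W.card * (2 * n * (q - 1) ^ (q * L)) := by ring
      _ ≤ W.card * q ^ (q * L) := Nat.mul_le_mul_left _ h2
      _ ≤ n * (q - 1) ^ (q * L) * q ^ n := h1
      _ = q ^ n * (n * (q - 1) ^ (q * L)) := mul_comm _ _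
  · intro x hx s hs
    by_contra hcon
    rw [Finset.mem_compl, hW, Finset.mem_filter] at hx
    refine hx ⟨Finset.mem_univ _, s, hs, fun k h1 h2 => ?_⟩
    rw [Finset.mem_erase]
    refine ⟨fun h => hcon ⟨k, h1, h2, by rw [h]⟩, Finset.mem_univ _⟩

/-- At least half of the words have no run of logarithmic length. -/
theorem exists_short_run_words (hq : 2 ≤ q) (hn : 1 ≤ n) :
    ∃ R : Finset (Word q n), (q : ℝ) ^ n ≤ 2 * R.card ∧
      ∀ x ∈ R, ∀ s, s + Nat.clog q (2 * q * n) ≤ n → ∀ c,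
        ∃ k : Fin n, s ≤ k.1 ∧ k.1 < s + Nat.clog q (2 * q * n) ∧ x k ≠ c := by
  classical
  set L := Nat.clog q (2 * q * n) with hL
  have hqn : 0 < q * n := Nat.mul_pos (by omega) hn
  have hL1 : 1 ≤ L := Nat.clog_pos (by omega) (by rw [mul_assoc]; omega)
  -- The factor `2 * q` pays for the union over the `q` letters and leaves one half.
  have hLn : 2 * q * n ≤ q ^ L := Nat.le_pow_clog (by omega) _
  set V : Fin q → Finset (Word q n) := fun c => Finset.univ.filter fun x =>
    ∃ s, s + L ≤ n ∧ ∀ k : Fin n, s ≤ k.1 → k.1 < s + L → x k ∈ ({c} : Finset (Fin q)) with hV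
  refine ⟨(Finset.univ.biUnion V)ᶜ, pow_le_two_mul_card_compl ?_, ?_⟩
  · have h1 : ∀ c, (V c).card * (2 * q) ≤ q ^ n := by
      intro c
      have h1 := card_window_mul_le {c} (W := V c) hL1 (fun x hx => (Finset.mem_filter.1 hx).2)
      rw [Finset.card_singleton, one_pow, mul_one] at h1
      refine Nat.le_of_mul_le_mul_right ?_ hn
      calc (V c).card * (2 * q) * n = (V c).card * (2 * q * n) := by ring
        _ ≤ (V c).card * q ^ L := Nat.mul_le_mul_left _ hLn
        _ ≤ n * q ^ n := h1
        _ = q ^ n * n := mul_comm _ _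
    have h2 : (Finset.univ.biUnion V).card ≤ ∑ c, (V c).card := Finset.card_biUnion_le
    have h3 : (∑ c, (V c).card) * (2 * q) ≤ q * q ^ n := by
      rw [Finset.sum_mul]
      refine (Finset.sum_le_card_nsmul _ _ _ fun c _ => h1 c).trans ?_
      simp
    refine Nat.le_of_mul_le_mul_left ?_ (show 0 < q by omega)
    calc q * (2 * (Finset.univ.biUnion V).card) = (Finset.univ.biUnion V).card * (2 * q) := by ring
      _ ≤ (∑ c, (V c).card) * (2 * q) := Nat.mul_le_mul_right _ h2
      _ ≤ q * q ^ n := h3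
  · intro x hx s hs c
    by_contra hcon
    refine Finset.mem_compl.1 hx (Finset.mem_biUnion.2 ⟨c, Finset.mem_univ _, ?_⟩)
    refine Finset.mem_filter.2 ⟨Finset.mem_univ _, s, hs, fun k h1 h2 => ?_⟩
    rw [Finset.mem_singleton]
    by_contra hne
    exact hcon ⟨k, h1, h2, hne⟩

theorem rhoSI_le_of_pos (hq : 2 ≤ q) (hn : 1 ≤ n) {N : ℕ} (hN : 0 < N) :
    rhoSI q n N ≤ Real.logb q
      (2 * ((2 * ((2 * (q * Nat.clog 2 (2 * n)) + 2 : ℕ) ^ q : ℕ) + 1) *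
        (n * ((2 * (q * Nat.clog 2 (2 * n)) + 2 : ℕ) ^ q : ℕ) + 1))) := by
  obtain ⟨R, hR, h⟩ := exists_dense_words hq hn
  exact rhoSI_le_of_dense hq hN R two_pos hR h

/-! ### Three reads: short runs and a short moment -/

/-- For `i ≤ k` and `k + 1 < j`, `x (k + 1) = y (k + 1) = Z (k + 1) = x k`. -/
theorem DelPair.run_left {x y : Word q n} {Z : ℕ → Fin q} {p r : ℕ} (h : DelPair x y Z p r)
    {i j : Fin n} (hi : x i ≠ y i) (hj : x j ≠ y j) (hrest : ∀ k, k ≠ i → k ≠ j → x k = y k) :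
    ∀ k : ℕ, i.1 ≤ k → ∀ hk : k < j.1, x ⟨k, hk.trans j.2⟩ = x i := by
  obtain ⟨a1, a2⟩ := h.mem_of_ne hi
  obtain ⟨a3, a4⟩ := h.mem_of_ne hj
  obtain ⟨-, -, h3, h4⟩ := h
  intro k hk
  induction k, hk using Nat.le_induction with
  | base => intro _; rfl
  | succ k hk ih =>
    intro hkj
    rw [← ih (by omega), hrest _ (by simp [Fin.ext_iff]; omega) (by simp [Fin.ext_iff]; omega),
      h3, h4, if_pos (by simp; omega), if_neg (by simp; omega)]

/-- Three common outputs need a common substitution and, as the weight excludes distance one, also a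
common insertion. The moment puts the two differing positions more than `L` apart, so some word of
`R` would have a run of length `L`. -/
theorem rhoSI_three_le (hq : 2 ≤ q) (hn : 1 ≤ n) :
    rhoSI q n 3 ≤ Real.logb q (2 * ((2 * q + 1) * (Nat.clog q (2 * q * n) * q + 1))) := by
  obtain ⟨R, hcard, hR⟩ := exists_short_run_words hq hn
  set L := Nat.clog q (2 * q * n)
  have hg : Function.Injective fun c : Fin q => (c.1 : ℤ) := fun a b h => by
    simpa [Fin.ext_iff] using h
  have hrun : ∀ x ∈ R, ∀ y, ∀ i j : Fin n, i < j → i.1 + L < j.1 → x i ≠ y i → x j ≠ y j →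
      (∀ k, k ≠ i → k ≠ j → x k = y k) → ∀ Z p r, ¬ DelPair x y Z p r := by
    intro x hx y i j hij hfar hi hj hrest Z p r hd
    have := j.2
    obtain ⟨k, h1, h2, h3⟩ := hR x hx i.1 (by omega) (x i)
    exact h3 (hd.run_left hi hj hrest k.1 h1 (by omega))
  have := rhoSI_le_of_syndrome hq (N := 3) (by omega)
    (syndrome (fun c : Fin q => (c.1 : ℤ)) (2 * q + 1) (L * q + 1)) R two_pos hcard (by
      intro x hx y hy hxy hs
      rw [card_siBall_inter]
      have hI := card_insWords_inter_le hxy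
      by_contra hcon
      have hne : (subWords x ∩ subWords y).Nonempty := Finset.card_pos.1 (by omega)
      obtain ⟨i, j, hij, hi, hj, hrest, hfar⟩ := exists_far_of_syndrome_eq hg
        (fun c => by positivity) (fun c => by exact_mod_cast c.2.le) (Nat.lt_succ_self (L * q)) hxy
        hs (hammingDist_le_two_of_subWords_inter hne)
      have hS := card_subWords_inter_le_two hij.ne hi hj
      obtain ⟨z, hz⟩ : (insWords x ∩ insWords y).Nonempty := Finset.card_pos.1 (by omega)
      rw [Finset.mem_inter] at hz
      obtain ⟨Z, p, r, hd | hd, -⟩ := exists_delPair hxy hz.1 hz.2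
      · exact hrun x hx y i j hij hfar hi hj hrest Z p r hd
      · exact hrun y hy x i j hij hfar hi.symm hj.symm (fun k h1 h2 => (hrest k h1 h2).symm)
          Z p r hd)
  rw [Fintype.card_prod, ZMod.card, ZMod.card] at this
  push_cast at this
  exact this

/-! ### Lower bounds: sphere packing and cliques -/

theorem logb_le_rhoSI_of_le_two (hq : 2 ≤ q) (hn : 1 ≤ n) {N : ℕ} (hN0 : 0 < N) (hN : N ≤ 2) :
    Real.logb q n ≤ rhoSI q n N := by
  refine logb_le_rhoSI hq hN0 (by exact_mod_cast hn) fun C hC => ?_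
  rw [isReconstructionCode_iff hN0] at hC
  have hdisj : (C : Set (Word q n)).PairwiseDisjoint subWords := by
    intro x hx y hy hxy
    rw [Function.onFun, Finset.disjoint_iff_inter_eq_empty, ← Finset.not_nonempty_iff_eq_empty]
    intro hne
    have h1 := one_lt_card_subWords_inter hxy hne
    have h2 := hC x hx y hy hxy
    rw [card_siBall_inter] at h2
    omega
  have h1 : C.card * n ≤ (C.biUnion subWords).card := by
    rw [Finset.card_biUnion hdisj]
    exact Finset.card_nsmul_le_sum _ _ _ fun x _ => le_card_subWords hq x
  have h2 : (C.biUnion subWords).card ≤ q ^ n := by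
    simpa using Finset.card_le_univ (C.biUnion subWords)
  rw [mul_comm]
  exact_mod_cast h1.trans h2

theorem card_le_pow_of_length {A : Type*} [Fintype A] [DecidableEq A] {m : ℕ} {S : Finset (List A)}
    (hS : ∀ l ∈ S, l.length = m) : S.card ≤ Fintype.card A ^ m := by
  have hsub : S ⊆ (Finset.univ : Finset (Fin m → A)).image List.ofFn := by
    intro l hl
    obtain rfl := hS l hl
    exact Finset.mem_image.2 ⟨l.get, Finset.mem_univ _, List.ofFn_get l⟩
  refine (Finset.card_le_card hsub).trans (Finset.card_image_le.trans ?_)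
  simp

/-- If no two members of `C` differ by replacing a factor in `D` by another one, then `C` has
density about `1 / |D|`. -/
theorem card_mul_le_of_clique {A : Type*} [Fintype A] [DecidableEq A] {m e : ℕ}
    {D : Finset (List A)} (hD : ∀ w ∈ D, w.length = m) (he : D.card + e = Fintype.card A ^ m)
    (r k : ℕ) (C : Finset (List A)) (hC : ∀ l ∈ C, l.length = m * k + r)
    (hfree : ∀ u v, ∀ w ∈ D, ∀ w' ∈ D, u ++ w ++ v ∈ C → u ++ w' ++ v ∈ C → w = w') :
    C.card * D.card ≤ Fintype.card A ^ (m * k + r) + D.card * e ^ k * Fintype.card A ^ r := by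
  classical
  induction k generalizing C with
  | zero =>
    have := card_le_pow_of_length hC
    simp only [mul_zero, zero_add, pow_zero, mul_one] at this ⊢
    nlinarith
  | succ k ih =>
    set a := Fintype.card A with ha
    set T : Finset (List A) := (Finset.univ : Finset (Fin m → A)).image List.ofFn with hT
    have hTmem : ∀ l : List A, l ∈ T ↔ l.length = m := by
      intro l
      constructor
      · intro h
        obtain ⟨f, -, rfl⟩ := Finset.mem_image.1 h
        simp
      · rintro rfl
        exact Finset.mem_image.2 ⟨l.get, Finset.mem_univ _, List.ofFn_get l⟩
    have hTcard : T.card = a ^ m := by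
      rw [hT, Finset.card_image_of_injective _ List.ofFn_injective]
      simp [ha]
    have hDT : D ⊆ T := fun w hw => (hTmem w).2 (hD w hw)
    have hlen : ∀ l ∈ C, l.length = m + (m * k + r) := by
      intro l hl
      rw [hC l hl]; ring
    -- `F w` holds the suffixes that follow the prefix `w`. For `w` in `D` these sets are disjoint;
    -- the `e` other prefixes go by induction. The error term comes from the words none of whose
    -- blocks lies in `D`.
    set F : List A → Finset (List A) := fun w =>
      (C.filter fun l => l.take m = w).image (List.drop m) with hF
    have hFmem : ∀ w v, v ∈ F w → w ++ v ∈ C := by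
      intro w v h
      obtain ⟨l, hl, rfl⟩ := Finset.mem_image.1 h
      obtain ⟨h1, rfl⟩ := Finset.mem_filter.1 hl
      rwa [List.take_append_drop]
    have hFcard : ∀ w, (F w).card = (C.filter fun l => l.take m = w).card := by
      intro w
      refine Finset.card_image_of_injOn fun l hl l' hl' h => ?_
      have h1 := (Finset.mem_filter.1 hl).2
      have h2 := (Finset.mem_filter.1 hl').2
      rw [← List.take_append_drop m l, ← List.take_append_drop m l', h1, h2, h]
    have hFlen : ∀ w, ∀ v ∈ F w, v.length = m * k + r := by
      intro w v h
      obtain ⟨l, hl, rfl⟩ := Finset.mem_image.1 h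
      rw [List.length_drop, hlen l (Finset.mem_filter.1 hl).1]
      omega
    have hsplit : C.card = ∑ w ∈ D, (F w).card + ∑ w ∈ T \ D, (F w).card := by
      rw [add_comm, Finset.sum_sdiff hDT, Finset.sum_congr rfl fun w _ => hFcard w]
      refine Finset.card_eq_sum_card_fiberwise fun l hl => ?_
      have hl' : l ∈ C := hl
      refine (hTmem _).2 ?_
      rw [List.length_take, hlen l hl']
      omega
    have h1 : ∑ w ∈ D, (F w).card ≤ a ^ (m * k + r) := by
      rw [← Finset.card_biUnion]
      · refine card_le_pow_of_length fun v hv => ?_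
        obtain ⟨w, -, hw⟩ := Finset.mem_biUnion.1 hv
        exact hFlen w v hw
      · intro w hw w' hw' hne
        rw [Function.onFun, Finset.disjoint_left]
        intro v hv hv'
        refine hne (hfree [] v w hw w' hw' ?_ ?_)
        · simpa using hFmem w v hv
        · simpa using hFmem w' v hv'
    have h2 : (∑ w ∈ T \ D, (F w).card) * D.card ≤
        e * (a ^ (m * k + r) + D.card * e ^ k * a ^ r) := by
      have hcard : (T \ D).card = e := by
        rw [Finset.card_sdiff_of_subset hDT, hTcard]
        omega
      rw [Finset.sum_mul, ← hcard, ← smul_eq_mul]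
      refine Finset.sum_le_card_nsmul _ _ _ fun w _ => ?_
      rw [hcard]
      refine ih (F w) (hFlen w) fun u v w₁ h₁ w₂ h₂ hv₁ hv₂ => ?_
      refine hfree (w ++ u) v w₁ h₁ w₂ h₂ ?_ ?_
      · simpa using hFmem w _ hv₁
      · simpa using hFmem w _ hv₂
    have h3 : a ^ (m * (k + 1) + r) = (D.card + e) * a ^ (m * k + r) := by
      rw [he, ← pow_add]
      congr 1
      ring
    rw [hsplit, add_mul, h3, pow_succ]
    nlinarith [Nat.mul_le_mul_right D.card h1]

/-- The clique bound for reconstruction codes. -/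
theorem card_mul_le_of_siBall_clique {N : ℕ} (hN : 0 < N) {m e : ℕ}
    {D : Finset (List (Fin q))} (hD : ∀ w ∈ D, w.length = m) (he : D.card + e = q ^ m)
    (hclique : ∀ (x y : Word q n) (u v w w' : List (Fin q)), w ∈ D → w' ∈ D → w ≠ w' →
      List.ofFn x = u ++ w ++ v → List.ofFn y = u ++ w' ++ v →
      N ≤ (siBall x ∩ siBall y).card)
    {C : Finset (Word q n)} (hC : IsReconstructionCode siBall N C) (r k : ℕ)
    (hn : n = m * k + r) : C.card * D.card ≤ q ^ n + D.card * e ^ k * q ^ r := by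
  rw [isReconstructionCode_iff hN] at hC
  have := card_mul_le_of_clique (A := Fin q) hD (by simpa using he) r k (C.image List.ofFn) (by
    intro l hl
    obtain ⟨x, -, rfl⟩ := Finset.mem_image.1 hl
    simpa using hn) (by
    intro u v w hw w' hw' h h'
    obtain ⟨x, hx, ex⟩ := Finset.mem_image.1 h
    obtain ⟨y, hy, ey⟩ := Finset.mem_image.1 h'
    by_contra hne
    have h1 := hclique x y u v w w' hw hw' hne ex ey
    refine absurd (hC x hx y hy ?_) (not_lt.2 h1)
    rintro rfl
    rw [ex] at ey
    exact hne (by simpa using ey))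
  rw [Finset.card_image_of_injective _ List.ofFn_injective, Fintype.card_fin, ← hn] at this
  exact this

/-- Any two of `00`, `01`, `10` differ by a substitution or a swap. Only `11` is left out, so the
error is `3 * 2 ^ r ≤ 6`. -/
theorem three_mul_card_le {C : Finset (Word 2 n)} (hC : IsReconstructionCode siBall 4 C) :
    3 * C.card ≤ 2 ^ n + 6 := by
  have := card_mul_le_of_siBall_clique (N := 4) (by omega) (m := 2) (e := 1)
    (D := {[0, 0], [0, 1], [1, 0]}) (by decide) (by decide) (by
      intro x y u v w w' hw hw' hne hx hy
      simp only [Finset.mem_insert, Finset.mem_singleton] at hw hw'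
      have h01 : (0 : Fin 2) ≠ 1 := by decide
      rcases hw with rfl | rfl | rfl <;> rcases hw' with rfl | rfl | rfl <;>
        simp only [ne_eq, not_true_eq_false] at hne
      · exact card_siBall_inter_of_subst (u := u ++ [0]) (v := v) h01
          (by simpa using hx) (by simpa using hy)
      · exact card_siBall_inter_of_subst (u := u) (v := 0 :: v) h01
          (by simpa using hx) (by simpa using hy)
      · exact card_siBall_inter_of_subst (u := u ++ [0]) (v := v) h01.symm
          (by simpa using hx) (by simpa using hy)
      · exact card_siBall_inter_of_swap (u := u) (v := v) h01
          (by simpa using hx) (by simpa using hy)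
      · exact card_siBall_inter_of_subst (u := u) (v := 0 :: v) h01.symm
          (by simpa using hx) (by simpa using hy)
      · exact card_siBall_inter_of_swap (u := u) (v := v) h01.symm
          (by simpa using hx) (by simpa using hy)) hC (n % 2) (n / 2) (Nat.div_add_mod n 2).symm
  have h3 : Finset.card ({[0, 0], [0, 1], [1, 0]} : Finset (List (Fin 2))) = 3 := by decide
  rw [h3] at this
  have h2 : 2 ^ (n % 2) ≤ 2 := by
    rcases Nat.mod_two_eq_zero_or_one n with h | h <;> simp [h]
  simp only [one_pow, mul_one] at this
  omega

/-- Bernoulli's inequality for `(1 + m / e) ^ k`, cleared of denominators. -/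
theorem mul_mul_pow_le (m e k : ℕ) : k * m * e ^ k ≤ e * (m + e) ^ k := by
  induction k with
  | zero => simp
  | succ k ih =>
    have h : e ^ k ≤ (m + e) ^ k := Nat.pow_le_pow_left (by omega) k
    calc (k + 1) * m * e ^ (k + 1) = e * (k * m * e ^ k) + m * e * e ^ k := by ring
      _ ≤ e * (e * (m + e) ^ k) + m * e * (m + e) ^ k := by gcongr
      _ = e * (m + e) ^ (k + 1) := by ring

/-- The clique consists of the `m` words of length `m` with one `1` among zeros, any two of which
differ by moving the `1` across zeros. The bound on `q ^ (2 * m)` gives at least `e` blocks, so the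
error is at most `q ^ n`. -/
theorem card_mul_le_of_three (hq : 2 ≤ q) {m : ℕ} (hm : 1 ≤ m) (hmn : q ^ (2 * m) ≤ n)
    {C : Finset (Word q n)} (hC : IsReconstructionCode siBall 3 C) :
    C.card * m ≤ 2 * q ^ n := by
  have : NeZero q := ⟨by omega⟩
  have h01 : (0 : Fin q) ≠ 1 := by
    intro h
    have := congrArg Fin.val h
    rw [Fin.val_zero, Fin.val_one', Nat.mod_eq_of_lt (by omega)] at this
    omega
  have hmq : m < q ^ m := Nat.lt_pow_self (by omega)
  obtain ⟨e, he⟩ : ∃ e, m + e = q ^ m := ⟨q ^ m - m, by omega⟩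
  set E : ℕ → List (Fin q) := fun i => List.replicate i 0 ++ 1 :: List.replicate (m - 1 - i) 0
    with hE
  have hEinj : ∀ i < m, ∀ j < m, i < j → E i ≠ E j := by
    intro i hi j hj hij h
    obtain ⟨t, rfl⟩ := Nat.exists_eq_add_of_lt hij
    rw [hE] at h
    dsimp only at h
    rw [add_assoc, ← List.replicate_append_replicate, List.append_assoc,
      List.append_cancel_left_eq, List.replicate_succ, List.cons_append, List.cons_eq_cons] at h
    exact h01 h.1.symm
  set D : Finset (List (Fin q)) := (Finset.range m).image E with hD
  have hDcard : D.card = m := by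
    rw [hD, Finset.card_image_of_injOn, Finset.card_range]
    intro i hi j hj h
    have hi' : i < m := by simpa using hi
    have hj' : j < m := by simpa using hj
    rcases lt_trichotomy i j with hij | hij | hij
    · exact absurd h (hEinj i hi' j hj' hij)
    · exact hij
    · exact absurd h.symm (hEinj j hj' i hi' hij)
  have hpair : ∀ (x y : Word q n) (u v : List (Fin q)) (i j : ℕ), i < j → j < m →
      List.ofFn x = u ++ E i ++ v → List.ofFn y = u ++ E j ++ v →
      3 ≤ (siBall x ∩ siBall y).card := by
    intro x y u v i j hij hj hx hy
    obtain ⟨t, rfl⟩ := Nat.exists_eq_add_of_lt hij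
    have h1 : m - 1 - i = t + (1 + (m - 1 - (i + t + 1))) := by omega
    refine card_siBall_inter_of_move (u := u ++ List.replicate i 0)
      (v := List.replicate (m - 1 - (i + t + 1)) 0 ++ v) (a := 0) (b := 1) (t := t) h01 ?_ ?_
    · rw [hx, hE]
      dsimp only
      rw [h1, ← List.replicate_append_replicate, ← List.replicate_append_replicate]
      simp
    · rw [hy, hE]
      dsimp only
      have h2 : List.replicate (i + t + 1) (0 : Fin q) =
          List.replicate i 0 ++ 0 :: List.replicate t 0 := by
        rw [add_assoc, ← List.replicate_append_replicate, List.replicate_succ]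
      rw [h2]
      simp
  have := card_mul_le_of_siBall_clique (N := 3) (by omega) (m := m) (e := e) (D := D) (by
      intro w hw
      obtain ⟨i, hi, rfl⟩ := Finset.mem_image.1 hw
      have := Finset.mem_range.1 hi
      simp [hE]
      omega) (by rw [hDcard, he]) (by
      intro x y u v w w' hw hw' hne hx hy
      obtain ⟨i, hi, rfl⟩ := Finset.mem_image.1 hw
      obtain ⟨j, hj, rfl⟩ := Finset.mem_image.1 hw'
      rw [Finset.mem_range] at hi hj
      rcases lt_trichotomy i j with hij | rfl | hij
      · exact hpair x y u v i j hij hj hx hy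
      · exact absurd rfl hne
      · rw [Finset.inter_comm]
        exact hpair y x u v j i hij hi hy hx) hC (n % m) (n / m) (Nat.div_add_mod n m).symm
  rw [hDcard] at this
  have hber : m * e ^ (n / m) ≤ (m + e) ^ (n / m) := by
    have hk : e ≤ n / m := by
      rw [Nat.le_div_iff_mul_le (by omega)]
      calc e * m ≤ q ^ m * q ^ m := Nat.mul_le_mul (by omega) hmq.le
        _ = q ^ (2 * m) := by rw [two_mul, pow_add]
        _ ≤ n := hmn
    refine Nat.le_of_mul_le_mul_left ?_ (show 0 < e by omega)
    calc e * (m * e ^ (n / m)) ≤ n / m * (m * e ^ (n / m)) := Nat.mul_le_mul_right _ hk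
      _ = n / m * m * e ^ (n / m) := by ring
      _ ≤ e * (m + e) ^ (n / m) := mul_mul_pow_le m e _
  have hfin : m * e ^ (n / m) * q ^ (n % m) ≤ q ^ n := by
    calc m * e ^ (n / m) * q ^ (n % m) ≤ (m + e) ^ (n / m) * q ^ (n % m) :=
          Nat.mul_le_mul_right _ hber
      _ = q ^ n := by rw [he, ← pow_mul, ← pow_add, Nat.div_add_mod]
  omega

/-! ### Asymptotics -/

open Filter

theorem natCast_clog_le (b m : ℕ) (hb : 2 ≤ b) (hm : 1 ≤ m) :
    (Nat.clog b m : ℝ) ≤ Real.logb b m + 1 := by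
  have hb1 : (1 : ℝ) < b := by exact_mod_cast hb
  rw [← Real.natCeil_logb_natCast]
  exact (Nat.ceil_lt_add_one (Real.logb_nonneg hb1 (by exact_mod_cast hm))).le

theorem tendsto_logb_natCast (hq : 2 ≤ q) :
    Tendsto (fun n : ℕ => Real.logb q n) atTop atTop :=
  (Real.tendsto_logb_atTop (by exact_mod_cast hq)).comp tendsto_natCast_atTop_atTop

theorem rhoSI_sub_logb_isBigO_of_two {N : ℕ} (hN0 : 0 < N) (hN : N ≤ 2) :
    (fun n : ℕ => rhoSI 2 n N - Real.logb 2 n) =O[atTop] fun _ : ℕ => (1 : ℝ) := by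
  refine Asymptotics.IsBigO.of_bound (Real.logb 2 6) ?_
  filter_upwards [eventually_ge_atTop 1] with n hn
  have hn' : (1 : ℝ) ≤ n := by exact_mod_cast hn
  have h1 := logb_le_rhoSI_of_le_two (n := n) le_rfl hn hN0 hN
  have h2 : rhoSI 2 n N ≤ _ := rhoSI_two_le (n := n) hN0
  have h3 : Real.logb 2 (3 * (n + 1)) ≤ Real.logb 2 (6 * n) :=
    Real.logb_le_logb_of_le one_lt_two (by positivity) (by linarith)
  rw [Real.logb_mul (x := 6) (by norm_num) (by positivity)] at h3
  push_cast at h1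
  rw [norm_one, mul_one, Real.norm_eq_abs, abs_le]
  have : 0 ≤ Real.logb 2 6 := Real.logb_nonneg one_lt_two (by norm_num)
  constructor <;> linarith

theorem rhoSI_sub_logb_isBigO (hq : 2 ≤ q) {N : ℕ} (hN0 : 0 < N) (hN : N ≤ 2) :
    (fun n : ℕ => rhoSI q n N - Real.logb q n) =O[atTop]
      fun n : ℕ => Real.logb q (Real.logb q n) := by
  have hq1 : (1 : ℝ) < q := by exact_mod_cast hq
  have hq0 : (0 : ℝ) < q := by linarith
  -- `A` bounds `G / log_q n` once `log_q n ≥ 1`, since `clog 2 (2 * n) ≤ log_2 q * log_q n + 2`.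
  set A : ℝ := 2 * (q * (Real.logb 2 q + 2)) + 2 with hA
  have hl2q : 0 ≤ Real.logb 2 q := Real.logb_nonneg one_lt_two hq1.le
  have hA1 : 1 ≤ A := by
    have : 0 ≤ q * (Real.logb 2 q + 2) := by positivity
    rw [hA]; linarith
  -- `12 = 2 * 3 * 2`: the density loss, and the two moduli with their `+ 1` absorbed.
  set c : ℝ := Real.logb q 12 + 2 * q * Real.logb q A with hc
  have hc0 : 0 ≤ c := by
    have h1 := Real.logb_nonneg hq1 (by norm_num : (1 : ℝ) ≤ 12)
    have h2 := Real.logb_nonneg hq1 hA1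
    positivity
  refine Asymptotics.IsBigO.of_bound (c + 2 * q) ?_
  filter_upwards [eventually_ge_atTop 1, (tendsto_logb_natCast hq).eventually_ge_atTop 1,
    ((Real.tendsto_logb_atTop hq1).comp (tendsto_logb_natCast hq)).eventually_ge_atTop 1]
    with n hn hlog hloglog
  simp only [Function.comp_apply] at hloglog
  have hn' : (1 : ℝ) ≤ n := by exact_mod_cast hn
  have h1 := logb_le_rhoSI_of_le_two hq hn hN0 hN
  have h2 := rhoSI_le_of_pos hq hn hN0
  set G : ℕ := 2 * (q * Nat.clog 2 (2 * n)) + 2 with hG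
  have hG0 : (0 : ℝ) < G := by rw [hG]; positivity
  have hG1 : (1 : ℝ) ≤ (G : ℝ) ^ q := one_le_pow₀ (by exact_mod_cast (by omega : 1 ≤ G))
  have hGA : (G : ℝ) ≤ A * Real.logb q n := by
    have h3 := natCast_clog_le 2 (2 * n) le_rfl (by omega)
    push_cast at h3
    rw [Real.logb_mul two_ne_zero (by positivity), Real.logb_self_eq_one one_lt_two,
      ← Real.mul_logb (a := 2) (b := q) (c := n) (by positivity) (by linarith)
        (by linarith)] at h3
    have h4 : (Nat.clog 2 (2 * n) : ℝ) ≤ (Real.logb 2 q + 2) * Real.logb q n := by nlinarith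
    have h5 : (q : ℝ) * Nat.clog 2 (2 * n) ≤ q * ((Real.logb 2 q + 2) * Real.logb q n) := by gcongr
    rw [hG, hA]
    push_cast
    nlinarith
  have h3 : Real.logb q G ≤ Real.logb q A + Real.logb q (Real.logb q n) := by
    rw [← Real.logb_mul (by positivity) (by positivity)]
    exact Real.logb_le_logb_of_le hq1 hG0 hGA
  have h4 : rhoSI q n N ≤ Real.logb q 12 + 2 * q * Real.logb q G + Real.logb q n := by
    refine h2.trans ?_
    have : Real.logb q 12 + 2 * q * Real.logb q G + Real.logb q n =
        Real.logb q (12 * ((G : ℝ) ^ q) ^ 2 * n) := by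
      rw [Real.logb_mul (by positivity) (by positivity), Real.logb_mul (by positivity)
        (by positivity), Real.logb_pow, Real.logb_pow]
      push_cast
      ring
    rw [this]
    refine Real.logb_le_logb_of_le hq1 (by positivity) ?_
    push_cast
    have e1 : 2 * (G : ℝ) ^ q + 1 ≤ 3 * (G : ℝ) ^ q := by linarith
    have e2 : n * (G : ℝ) ^ q + 1 ≤ 2 * (n * (G : ℝ) ^ q) := by nlinarith
    calc 2 * ((2 * (G : ℝ) ^ q + 1) * (n * (G : ℝ) ^ q + 1))
        ≤ 2 * (3 * (G : ℝ) ^ q * (2 * (n * (G : ℝ) ^ q))) := by gcongr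
      _ = 12 * ((G : ℝ) ^ q) ^ 2 * n := by ring
  rw [Real.norm_eq_abs, Real.norm_eq_abs, abs_of_nonneg (by linarith),
    abs_of_nonneg (by linarith : 0 ≤ Real.logb q (Real.logb q n))]
  have h5 : 2 * (q : ℝ) * Real.logb q G ≤
      2 * q * (Real.logb q A + Real.logb q (Real.logb q n)) := by gcongr
  have h6 : c * 1 ≤ c * Real.logb q (Real.logb q n) := by gcongr
  rw [hc] at h6 ⊢
  linarith

theorem rhoSI_three_sub_isBigO (hq : 2 ≤ q) :
    (fun n : ℕ => rhoSI q n 3 - Real.logb q (Real.logb q n)) =O[atTop]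
      fun _ : ℕ => (1 : ℝ) := by
  have hq1 : (1 : ℝ) < q := by exact_mod_cast hq
  have hq0 : (0 : ℝ) < q := by linarith
  set A : ℝ := Real.logb q (2 * q) + 2 with hA
  have hA0 : 0 ≤ A := by
    have := Real.logb_nonneg hq1 (by linarith : (1 : ℝ) ≤ 2 * q)
    linarith
  set c : ℝ := Real.logb q (2 * ((2 * q + 1) * (A * q + 1))) with hc
  -- `8 = 2 * 4`: the `2` of `card_mul_le_of_three`, and `l + 1 ≤ 4 * (l / 2)` for `l = Nat.log q n
  -- ≥ 2`, which `q ^ 2 ≤ n` ensures.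
  refine Asymptotics.IsBigO.of_bound (max c (Real.logb q 8)) ?_
  filter_upwards [eventually_ge_atTop (q ^ 2), (tendsto_logb_natCast hq).eventually_ge_atTop 1]
    with n hn2 hlog
  have hn : 1 ≤ n := le_trans (Nat.one_le_pow _ _ (by omega)) hn2
  have hn' : (1 : ℝ) ≤ n := by exact_mod_cast hn
  have hupper : rhoSI q n 3 ≤ c + Real.logb q (Real.logb q n) := by
    refine (rhoSI_three_le hq hn).trans ?_
    rw [hc, ← Real.logb_mul (by positivity) (by positivity)]
    refine Real.logb_le_logb_of_le hq1 (by positivity) ?_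
    have h1 := natCast_clog_le q (2 * q * n) hq (Nat.mul_pos (by omega) hn)
    push_cast at h1
    rw [Real.logb_mul (by positivity) (by positivity)] at h1
    have h2 := Real.logb_nonneg hq1 (by linarith : (1 : ℝ) ≤ 2 * q)
    have h3 : (Nat.clog q (2 * q * n) : ℝ) ≤ A * Real.logb q n := by
      rw [hA]; nlinarith
    have h4 : (Nat.clog q (2 * q * n) : ℝ) * q + 1 ≤ (A * q + 1) * Real.logb q n := by nlinarith
    calc (2 : ℝ) * ((2 * q + 1) * (Nat.clog q (2 * q * n) * q + 1))
        ≤ 2 * ((2 * q + 1) * ((A * q + 1) * Real.logb q n)) := by gcongr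
      _ = 2 * ((2 * q + 1) * (A * q + 1)) * Real.logb q n := by ring
  have hlower : Real.logb q (Real.logb q n) - Real.logb q 8 ≤ rhoSI q n 3 := by
    set l := Nat.log q n with hl
    have hl2 : 2 ≤ l := Nat.le_log_of_pow_le (by omega) hn2
    have hm : 1 ≤ l / 2 := by omega
    have hm' : (1 : ℝ) ≤ (l / 2 : ℕ) := by exact_mod_cast hm
    have hmn : q ^ (2 * (l / 2)) ≤ n :=
      (Nat.pow_le_pow_right (by omega) (by omega)).trans (Nat.pow_log_le_self q (by omega))
    have h1 : Real.logb q ((l / 2 : ℕ) / 2) ≤ rhoSI q n 3 :=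
      logb_le_rhoSI hq (by omega) (by positivity) fun C hC => by
        have := card_mul_le_of_three hq hm hmn hC
        have : (C.card : ℝ) * (l / 2 : ℕ) ≤ 2 * (q : ℝ) ^ n := by exact_mod_cast this
        linarith
    refine le_trans ?_ h1
    rw [← Real.logb_div (by positivity) (by norm_num)]
    refine Real.logb_le_logb_of_le hq1 (by positivity) ?_
    have h2 : Real.logb q n ≤ (l + 1 : ℕ) := by
      rw [Real.logb_le_iff_le_rpow hq1 (by positivity), Real.rpow_natCast]
      exact_mod_cast (Nat.lt_pow_succ_log_self (by omega) n).le
    have h3 : ((l + 1 : ℕ) : ℝ) ≤ 4 * (l / 2 : ℕ) := by exact_mod_cast (by omega)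
    linarith
  rw [norm_one, mul_one, Real.norm_eq_abs, abs_le]
  constructor
  · have := le_max_right c (Real.logb q 8)
    linarith
  · have := le_max_left c (Real.logb q 8)
    linarith

theorem le_rhoSI_two_four (n : ℕ) :
    2 - (Real.logb 2 (4 / 3) + Real.logb 2 (1 + 6 / 2 ^ n)) ≤ rhoSI 2 n 4 := by
  have h1 : Real.logb 2 (3 / (1 + 6 / 2 ^ n)) ≤ rhoSI 2 n 4 :=
    logb_le_rhoSI (n := n) le_rfl (by omega) (by positivity) fun C hC => by
      have h : (3 : ℝ) * C.card ≤ 2 ^ n + 6 := by exact_mod_cast three_mul_card_le hC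
      have h2 : (2 : ℝ) ^ n * (1 + 6 / 2 ^ n) = 2 ^ n + 6 := by field_simp
      rw [div_mul_eq_mul_div, div_le_iff₀ (by positivity)]
      push_cast
      linarith
  refine le_trans (le_of_eq ?_) h1
  have h4 : Real.logb 2 4 = 2 := by
    rw [show (4 : ℝ) = 2 ^ (2 : ℕ) by norm_num, Real.logb_pow, Real.logb_self_eq_one one_lt_two]
    norm_num
  have h5 : (1 : ℝ) + 6 / 2 ^ n ≠ 0 := by positivity
  rw [Real.logb_div (by norm_num) h5, Real.logb_div (by norm_num) (by norm_num), h4]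
  ring

theorem tendsto_neg_logb_one_add :
    Tendsto (fun n : ℕ => -Real.logb 2 (1 + 6 / 2 ^ n)) atTop (nhds 0) := by
  have h1 : Tendsto (fun n : ℕ => 1 + 6 / (2 : ℝ) ^ n) atTop (nhds (1 + 0)) :=
    tendsto_const_nhds.add (tendsto_const_nhds.div_atTop (tendsto_pow_atTop_atTop_of_one_lt
      one_lt_two))
  rw [add_zero] at h1
  have h2 := (Real.continuousAt_log one_ne_zero).tendsto.comp h1
  have h3 := (h2.div_const (Real.log 2)).neg
  simpa [Real.logb] using h3

end Reconstruction

theorem mainTheorem11 (q : ℕ) (hq : 2 ≤ q) :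
    -- `N ∈ {1, 2}` and `q = 2`
    (∀ N : ℕ, 1 ≤ N → N ≤ 2 → q = 2 →
      (fun n : ℕ => Reconstruction.rhoSI q n N - Real.logb 2 n)
        =O[Filter.atTop] fun _ : ℕ => (1 : ℝ)) ∧
    -- `N ∈ {1, 2}` and `q ≥ 3`
    (∀ N : ℕ, 1 ≤ N → N ≤ 2 → 3 ≤ q →
      (fun n : ℕ => Reconstruction.rhoSI q n N - Real.logb q n)
        =O[Filter.atTop] fun n : ℕ => Real.logb q (Real.logb q n)) ∧
    -- `N = 3`
    ((fun n : ℕ => Reconstruction.rhoSI q n 3 - Real.logb q (Real.logb q n))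
        =O[Filter.atTop] fun _ : ℕ => (1 : ℝ)) ∧
    -- `N = 4`
    (∃ ε : ℕ → ℝ,
      (∀ n : ℕ, 1 ≤ n → Reconstruction.rhoSI q n 4 = 2 - ε n) ∧
      (∀ n : ℕ, 1 ≤ n → 0 ≤ ε n) ∧
      (q = 2 → ∃ δ : ℕ → ℝ, Filter.Tendsto δ Filter.atTop (nhds 0) ∧
        ∀ n : ℕ, 1 ≤ n → ε n ≤ Real.logb 2 (4 / 3) - δ n) ∧
      (3 ≤ q → ∀ n : ℕ, 1 ≤ n → ε n ≤ 1)) ∧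
    -- `5 ≤ N ≤ q + 2`
    (∀ N : ℕ, 5 ≤ N → N ≤ q + 2 → ∀ n : ℕ, 1 ≤ n → Reconstruction.rhoSI q n N = 1) ∧
    -- `N ≥ q + 3`
    (∀ N : ℕ, q + 3 ≤ N → ∀ n : ℕ, 1 ≤ n → Reconstruction.rhoSI q n N = 0) := by
  refine ⟨?_, ?_, Reconstruction.rhoSI_three_sub_isBigO hq, ?_, ?_, ?_⟩
  · rintro N hN0 hN rfl
    exact Reconstruction.rhoSI_sub_logb_isBigO_of_two hN0 hN
  · intro N hN0 hN _
    exact Reconstruction.rhoSI_sub_logb_isBigO hq hN0 hN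
  · refine ⟨fun n => 2 - Reconstruction.rhoSI q n 4, fun n _ => by ring, fun n _ => ?_, ?_, ?_⟩
    · linarith [Reconstruction.rhoSI_four_le_two (n := n) hq]
    · rintro rfl
      -- `δ` is negative here: it absorbs the additive `6` of `three_mul_card_le`.
      refine ⟨_, Reconstruction.tendsto_neg_logb_one_add, fun n _ => ?_⟩
      linarith [Reconstruction.le_rhoSI_two_four n]
    · intro _ n hn
      linarith [Reconstruction.one_le_rhoSI hq hn (N := 4) (by omega) (by omega)]
  · intro N hN hN' n hn
    exact Reconstruction.rhoSI_eq_one hq hn hN hN'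
  · intro N hN n _
    exact Reconstruction.rhoSI_eq_zero hq hN
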